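/- For $n\ge 0$ let $T_n$ be the number of chambers (connected components of the complement) of the threshold arrangement in $\mathbb{R}^{n+1}$, which consists of all hyperplanes $\{x:\langle x,v\rangle=0\}$ with $v\in\{-1,1\}^{n+1}$; then $T_n$ is also the number of linear threshold functions on $n$ variables, i.e. of functions $f:\{-1,1\}^n\to\{-1,1\}$ of the form $f(x)=\operatorname{sgn}(t+a\cdot x)$ with $t\in\mathbb{R}$, $a\in\mathbb{R}^n$ (where $\operatorname{sgn}(s)=1$ for $s\ge 0$ and $-1$ for $s<0$). Let $R_n$ be the number of chambers (defined in the same way) of the resonance arrangement of rank $n$, whose ambient space is $V=\{x\in\mathbb{R}^{n+1}:\sum_i x_i=0\}$ and whose hyperplanes are $\{x\in V:\sum_{i\in S}x_i=0\}$ for all $\emptyset\ne S\subsetneq\{1,\dots,n+1\}$. For every $n\ge 2$, $$\frac{n+1}{2^{n+1}}\,T_n<R_n<\frac12\,T_n,$$ and $$n^2-\frac{10n^2}{\ln n}-n+\log_2(n+1)-1<\log_2R_n<n^2-1.$$ Consequently $\log_2R_n\sim n^2$ as $n\to\infty$. -/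

import Mathlib

open Filter Asymptotics

/-- The linear hyperplane `{x : ⟨x, v⟩ = 0}` of `ℝ^ι` with normal vector `v`. -/
def normalHyperplane {ι : Type*} [Fintype ι] (v : ι → ℝ) : Submodule ℝ (ι → ℝ) where
  carrier := {x | x ⬝ᵥ v = 0}
  add_mem' := fun {x y} hx hy => by
    rw [Set.mem_ofPred_eq] at hx hy ⊢
    rw [add_dotProduct, hx, hy, add_zero]
  zero_mem' := zero_dotProduct v
  smul_mem' := fun c x hx => by
    rw [Set.mem_ofPred_eq] at hx ⊢
    rw [smul_dotProduct, hx, smul_zero]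

/-- The complement of the union of the hyperplanes of a (central) arrangement `A`. -/
def arrangementComplement {V : Type*} [AddCommGroup V] [Module ℝ V]
    (A : Set (Submodule ℝ V)) : Set V :=
  {x | ∀ H ∈ A, x ∉ H}

/-- The number of chambers of an arrangement: the number of connected components of the
complement of the union of its hyperplanes. -/
noncomputable def numChambers {V : Type*} [AddCommGroup V] [Module ℝ V] [TopologicalSpace V]
    (A : Set (Submodule ℝ V)) : ℕ :=
  Nat.card (ConnectedComponents (arrangementComplement A))

/-- The threshold arrangement in `ℝ^m`: all hyperplanes whose normal vector has all its
entries in `{-1, 1}`. -/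
def thresholdArrangement (m : ℕ) : Set (Submodule ℝ (Fin m → ℝ)) :=
  {H | ∃ v : Fin m → ℝ, (∀ i, v i = 1 ∨ v i = -1) ∧ H = normalHyperplane v}

/-- `T_n`: the number of chambers of the threshold arrangement in `ℝ^(n+1)`. -/
noncomputable def numThreshold (n : ℕ) : ℕ :=
  numChambers (thresholdArrangement (n + 1))

/-- The 0/1 indicator vector `u_S` of `S`. -/
def indicatorVector {m : ℕ} (S : Finset (Fin m)) : Fin m → ℝ :=
  fun i => if i ∈ S then 1 else 0

/-- The space of vectors in `ℝ^m` with coordinate sum zero. -/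
def zeroSumSpace (m : ℕ) : Submodule ℝ (Fin m → ℝ) :=
  normalHyperplane (fun _ => 1)

/-- The resonance arrangement of rank `n`. Its ambient space is the space of zero-sum vectors of
`ℝ^(n+1)`, and its hyperplanes are the intersections with this space of the hyperplanes normal
to `u_S`, for the nonempty proper subsets `S` of the index set. -/
def resonanceArrangement (n : ℕ) : Set (Submodule ℝ (zeroSumSpace (n + 1))) :=
  {H | ∃ S : Finset (Fin (n + 1)), S.Nonempty ∧ S ≠ Finset.univ ∧
    H = (normalHyperplane (indicatorVector S)).comap (zeroSumSpace (n + 1)).subtype}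

/-- `R_n`: the number of chambers of the resonance arrangement of rank `n`. -/
noncomputable def numResonance (n : ℕ) : ℕ :=
  numChambers (resonanceArrangement n)

/-- `f : {-1,1}^n → {-1,1}` is a linear threshold function: `f x = sgn (t + a ⬝ x)` for some
threshold `t` and weight vector `a`, with `sgn s = 1` for `s ≥ 0` and `sgn s = -1` for `s < 0`.
The set `{-1,1}` is the unit group of `ℤ`. -/
def IsThresholdFunction {n : ℕ} (f : (Fin n → ℤˣ) → ℤˣ) : Prop :=
  ∃ (t : ℝ) (a : Fin n → ℝ), ∀ x : Fin n → ℤˣ,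
    f x = if 0 ≤ t + ∑ i, a i * ((x i : ℤ) : ℝ) then 1 else -1

/-! Chambers correspond to realizable sign patterns (`numChambers_eq_ncard_signSets`). Choosing from
each pair ±v the normal with first entry 1 indexes the threshold hyperplanes by the cube {-1,1}^n.
On the zero-sum space, the hyperplane with all-ones normal, the remaining ones cut out exactly the
resonance arrangement, so R_n counts the pairs of adjacent threshold chambers separated by that
hyperplane (`signSets_restrict`).

Sign changes of coordinates permute the hyperplanes transitively, so each separates R_n such pairs
and there are 2^(n+1) R_n incidences (chamber, wall). Every chamber has at least n+1 walls and one
has 2^n > n+1, which gives the lower comparison with T_n. For the upper one, x ↦ -x puts half of the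
chambers on the negative side of the all-ones hyperplane, and one of these does not have it as a
wall.

The upper bound T_n ≤ 2^(n^2) is Sauer–Shelah: shattered sets of cube points have independent forms,
hence at most n+1 elements.

For the lower bound, T_n is at least the number of strongly shattered sets, and a set S is strongly
shattered when its forms are independent and span no further threshold form. Such sets come from the
columns of generic n × p sign matrices. By Littlewood–Offord and a union bound, at least half of all
sign matrices are generic when p is about n - 8n/ln n and ln n ≥ 10. A set of columns arises from at
most p^p matrices, so T_n ≥ 2^(pn) / (2 p^p). When ln n < 10 the claimed lower bound for log R_n is
negative. -/

/-! ### Chambers as sign patterns -/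

/-- The subsets `s` of `J` which are the sets of indices in `J` of the forms that are positive at
some point lying on none of the hyperplanes indexed by `J`. -/
def signSets {ι V : Type*} [AddCommGroup V] [Module ℝ V] (J : Finset ι)
    (φ : ι → Module.Dual ℝ V) : Set (Finset ι) :=
  {s | s ⊆ J ∧ ∃ y, ∀ i ∈ J, (i ∈ s → 0 < φ i y) ∧ (i ∉ s → φ i y < 0)}

/-- The sign pattern is locally constant on the complement, hence constant on components. The points
with a given pattern form a convex, hence connected, set, so distinct components have distinct
patterns. -/
theorem numChambers_eq_ncard_signSets {ι V : Type*} [AddCommGroup V] [Module ℝ V]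
    [TopologicalSpace V] [IsTopologicalAddGroup V] [ContinuousSMul ℝ V] (J : Finset ι)
    (φ : ι → Module.Dual ℝ V) (hφ : ∀ i, Continuous (φ i)) :
    numChambers ((fun i => LinearMap.ker (φ i)) '' (J : Set ι)) = (signSets J φ).ncard := by
  classical
  set A := (fun i => LinearMap.ker (φ i)) '' (J : Set ι) with hA
  have hX : ∀ x : arrangementComplement A, ∀ i ∈ J, φ i x ≠ 0 := by
    intro x i hi h
    exact x.2 _ ⟨i, hi, rfl⟩ h
  let f : arrangementComplement A → Finset ι := fun x => J.filter fun i => 0 < φ i x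
  have hf : IsLocallyConstant f := by
    rw [IsLocallyConstant.iff_eventually_eq]
    intro x
    have : ∀ i ∈ J, ∀ᶠ y : arrangementComplement A in nhds x, (0 < φ i y ↔ 0 < φ i x) := by
      intro i hi
      have hc : ContinuousAt (fun y : arrangementComplement A => φ i y) x :=
        ((hφ i).comp continuous_subtype_val).continuousAt
      rcases lt_or_gt_of_ne (hX x i hi) with h | h
      · filter_upwards [hc.eventually (gt_mem_nhds h)] with y hy
        exact ⟨fun h' => absurd h' (not_lt.2 hy.le), fun h' => absurd h' (not_lt.2 h.le)⟩
      · filter_upwards [hc.eventually (lt_mem_nhds h)] with y hy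
        exact ⟨fun _ => h, fun _ => hy⟩
    filter_upwards [(Filter.eventually_all_finset J).2 this] with y hy
    exact Finset.filter_congr fun i hi => hy i hi
  have hmatch : ∀ (x : arrangementComplement A) (i) (_ : i ∈ J),
      (i ∈ f x → 0 < φ i x) ∧ (i ∉ f x → φ i x < 0) := by
    intro x i hi
    refine ⟨fun h => (Finset.mem_filter.1 h).2, fun h => ?_⟩
    refine lt_of_le_of_ne (not_lt.1 fun h' => h (Finset.mem_filter.2 ⟨hi, h'⟩)) (hX x i hi)
  let g : ConnectedComponents (arrangementComplement A) → Finset ι :=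
    Quotient.lift f fun x y hxy => by
      have hxy' : connectedComponent x = connectedComponent y := hxy
      exact hf.apply_eq_of_isPreconnected isPreconnected_connectedComponent mem_connectedComponent
        (hxy' ▸ mem_connectedComponent)
  have hg : Function.Injective g := by
    intro a b
    obtain ⟨x, rfl⟩ := ConnectedComponents.surjective_coe a
    obtain ⟨y, rfl⟩ := ConnectedComponents.surjective_coe b
    intro hxy
    replace hxy : f x = f y := hxy
    rw [ConnectedComponents.coe_eq_coe]
    let C : Set V := ⋂ i ∈ J, {z | (i ∈ f x → 0 < φ i z) ∧ (i ∉ f x → φ i z < 0)}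
    have hC : Convex ℝ C := by
      refine convex_iInter₂ fun i hi => ?_
      by_cases h : i ∈ f x
      · simpa [h] using convex_halfSpace_gt (φ i).isLinear 0
      · simpa [h] using convex_halfSpace_lt (φ i).isLinear 0
    have hCX : C ⊆ arrangementComplement A := by
      rintro z hz _ ⟨i, hi, rfl⟩ h0
      have h0' : φ i z = 0 := h0
      have := (Set.mem_iInter₂.1 hz) i hi
      by_cases h : i ∈ f x
      · exact (this.1 h).ne' h0'
      · exact (this.2 h).ne h0'
    have hpre : IsPreconnected ((↑) ⁻¹' C : Set (arrangementComplement A)) := by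
      rw [← Topology.IsInducing.subtypeVal.isPreconnected_image, Subtype.image_preimage_coe,
        Set.inter_eq_right.2 hCX]
      exact hC.isPreconnected
    apply connectedComponent_eq
    refine hpre.subset_connectedComponent (x := x) ?_ ?_
    · exact Set.mem_iInter₂.2 fun i hi => hmatch x i hi
    · exact Set.mem_iInter₂.2 fun i hi => hxy ▸ hmatch y i hi
  have hrange : Set.range g = signSets J φ := by
    ext s
    constructor
    · rintro ⟨a, rfl⟩
      obtain ⟨x, rfl⟩ := ConnectedComponents.surjective_coe a
      exact ⟨Finset.filter_subset _ _, x, hmatch x⟩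
    · rintro ⟨hs, y, hy⟩
      have hyA : y ∈ arrangementComplement A := by
        rintro _ ⟨i, hi, rfl⟩ h0
        have h0' : φ i y = 0 := h0
        by_cases h : i ∈ s
        · exact ((hy i hi).1 h).ne' h0'
        · exact ((hy i hi).2 h).ne h0'
      refine ⟨((⟨y, hyA⟩ : arrangementComplement A) : ConnectedComponents _), ?_⟩
      ext i
      constructor
      · intro h
        obtain ⟨hi, h⟩ := Finset.mem_filter.1 h
        by_contra h'
        exact absurd h (not_lt.2 ((hy i hi).2 h').le)
      · intro h
        exact Finset.mem_filter.2 ⟨hs h, (hy i (hs h)).1 h⟩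
  rw [numChambers, ← hrange, ← Nat.card_coe_set_eq, Nat.card_range_of_injective hg]

/-! ### Generic points and small perturbations -/

/-- A real vector space is not a finite union of proper subspaces. -/
theorem exists_forall_dual_ne_zero {ι V : Type*} [AddCommGroup V] [Module ℝ V] (J : Finset ι)
    (φ : ι → Module.Dual ℝ V) (hφ : ∀ i ∈ J, φ i ≠ 0) : ∃ y, ∀ i ∈ J, φ i y ≠ 0 := by
  classical
  by_contra! h
  have := Subspace.top_mem_of_biUnion_eq_univ (k := ℝ) (E := V)
    (s := J.image fun i => LinearMap.ker (φ i)) (by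
      refine Set.eq_univ_of_forall fun y => ?_
      obtain ⟨i, hi, hy⟩ := h y
      simp only [Set.mem_iUnion]
      exact ⟨_, Finset.mem_image_of_mem _ hi, hy⟩)
  obtain ⟨i, hi, h⟩ := Finset.mem_image.1 this
  exact hφ i hi (LinearMap.ker_eq_top.1 h)

/-- A small multiple of `g` can be added to `z` without changing the sign of any of finitely many
forms that do not vanish at `z`, while the other ones get their sign at `g`. -/
theorem exists_pos_perturbation {ι V : Type*} [AddCommGroup V] [Module ℝ V] (J : Finset ι)
    (φ : ι → Module.Dual ℝ V) (z g : V) :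
    ∃ ε : ℝ, 0 < ε ∧ ∀ i ∈ J, (0 < φ i z → 0 < φ i (z + ε • g)) ∧
      (φ i z < 0 → φ i (z + ε • g) < 0) ∧ (φ i z = 0 → φ i (z + ε • g) = ε * φ i g) := by
  have h : ∀ i ∈ J, ∀ᶠ ε : ℝ in nhdsWithin 0 (Set.Ioi 0), (0 < φ i z → 0 < φ i (z + ε • g)) ∧
      (φ i z < 0 → φ i (z + ε • g) < 0) ∧ (φ i z = 0 → φ i (z + ε • g) = ε * φ i g) := by
    intro i _
    have hc : ContinuousAt (fun ε : ℝ => φ i (z + ε • g)) 0 := by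
      simp only [map_add, map_smul, smul_eq_mul]
      fun_prop
    have hc0 : (fun ε : ℝ => φ i (z + ε • g)) 0 = φ i z := by simp
    apply Filter.Eventually.filter_mono nhdsWithin_le_nhds
    rcases lt_trichotomy (φ i z) 0 with h | h | h
    · filter_upwards [hc.eventually (gt_mem_nhds (hc0 ▸ h))] with ε hε
      exact ⟨fun h' => absurd h' (not_lt.2 h.le), fun _ => hε, fun h' => absurd h' h.ne⟩
    · filter_upwards with ε
      simp [h]
    · filter_upwards [hc.eventually (lt_mem_nhds (hc0 ▸ h))] with ε hε
      exact ⟨fun _ => hε, fun h' => absurd h' (not_lt.2 h.le), fun h' => absurd h' h.ne'⟩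
  obtain ⟨ε, hε, h0⟩ := (((Filter.eventually_all_finset J).2 h).and
    self_mem_nhdsWithin).exists
  exact ⟨ε, h0, hε⟩

/-- A point can be moved off finitely many hyperplanes without crossing any of them. -/
theorem exists_generic_perturbation {ι V : Type*} [AddCommGroup V] [Module ℝ V] (J : Finset ι)
    (φ : ι → Module.Dual ℝ V) (hφ : ∀ i ∈ J, φ i ≠ 0) (z : V) :
    ∃ y, ∀ i ∈ J, φ i y ≠ 0 ∧ (0 < φ i z → 0 < φ i y) ∧ (φ i z < 0 → φ i y < 0) := by
  obtain ⟨g, hg⟩ := exists_forall_dual_ne_zero J φ hφ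
  obtain ⟨ε, hε, h⟩ := exists_pos_perturbation J φ z g
  refine ⟨z + ε • g, fun i hi => ⟨?_, (h i hi).1, (h i hi).2.1⟩⟩
  rcases lt_trichotomy (φ i z) 0 with h' | h' | h'
  · exact ((h i hi).2.1 h').ne
  · rw [(h i hi).2.2 h']
    exact mul_ne_zero hε.ne' (hg i hi)
  · exact ((h i hi).1 h').ne'

theorem Finset.symmDiff_singleton_of_mem {ι : Type*} [DecidableEq ι] {s : Finset ι} {i : ι}
    (h : i ∈ s) :
    symmDiff s {i} = s.erase i := by
  ext j
  by_cases hj : j = i <;> simp [Finset.mem_symmDiff, hj, h]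

theorem Finset.symmDiff_singleton_of_notMem {ι : Type*} [DecidableEq ι] {s : Finset ι} {i : ι}
    (h : i ∉ s) :
    symmDiff s {i} = insert i s := by
  ext j
  by_cases hj : j = i <;> simp [Finset.mem_symmDiff, hj, h]

/-! ### Restriction to a hyperplane and walls of chambers -/

section Walls

variable {ι V : Type*} [Fintype ι] [DecidableEq ι] [AddCommGroup V] [Module ℝ V]

/-- The chambers of the restriction of an arrangement to one of its hyperplanes correspond to the
pairs of adjacent chambers separated by this hyperplane. -/
theorem signSets_restrict (φ : ι → Module.Dual ℝ V) (i₀ : ι) (h₀ : φ i₀ ≠ 0)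
    (W : Submodule ℝ V) (hW : ∀ y, y ∈ W ↔ φ i₀ y = 0) :
    signSets (Finset.univ.erase i₀) (fun i => (φ i).comp W.subtype) =
      {s | i₀ ∉ s ∧ s ∈ signSets Finset.univ φ ∧ insert i₀ s ∈ signSets Finset.univ φ} := by
  ext s
  constructor
  · rintro ⟨hs, ⟨w, hw⟩, h⟩
    have hi₀ : i₀ ∉ s := fun h => Finset.notMem_erase _ _ (hs h)
    have hw0 := (hW w).1 hw
    obtain ⟨g, hg⟩ : ∃ g, φ i₀ g ≠ 0 := by
      by_contra! h
      exact h₀ (LinearMap.ext h)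
    -- Leaving the hyperplane from `w` in direction `g` keeps all other signs and lands on the side
    -- of `g`; used for `g` and `-g`, this gives the two adjacent chambers.
    have key : ∀ g, φ i₀ g ≠ 0 → ∃ y, (0 < φ i₀ y ↔ 0 < φ i₀ g) ∧ φ i₀ y ≠ 0 ∧
        ∀ i ≠ i₀, (i ∈ s → 0 < φ i y) ∧ (i ∉ s → φ i y < 0) := by
      intro g hg
      obtain ⟨ε, hε, hy⟩ := exists_pos_perturbation Finset.univ φ w g
      refine ⟨w + ε • g, ?_, ?_, fun i hi => ?_⟩
      · rw [(hy i₀ (Finset.mem_univ _)).2.2 hw0]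
        exact mul_pos_iff_of_pos_left hε
      · rw [(hy i₀ (Finset.mem_univ _)).2.2 hw0]
        exact mul_ne_zero hε.ne' hg
      · have := h i (Finset.mem_erase.2 ⟨hi, Finset.mem_univ _⟩)
        exact ⟨fun his => (hy i (Finset.mem_univ _)).1 (this.1 his),
          fun his => (hy i (Finset.mem_univ _)).2.1 (this.2 his)⟩
    obtain ⟨g, hg⟩ : ∃ g, 0 < φ i₀ g := by
      rcases lt_or_gt_of_ne hg with h | h
      · exact ⟨-g, by simpa using h⟩
      · exact ⟨g, h⟩
    refine ⟨hi₀, ⟨Finset.subset_univ _, ?_⟩, ⟨Finset.subset_univ _, ?_⟩⟩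
    · obtain ⟨y, h1, h2, h3⟩ := key (-g) (by simpa using hg.ne')
      refine ⟨y, fun i _ => ?_⟩
      by_cases hi : i = i₀
      · subst hi
        refine ⟨fun h => absurd h hi₀, fun _ => lt_of_le_of_ne (not_lt.1 fun h => ?_) h2⟩
        have := h1.1 h
        rw [map_neg] at this
        linarith
      · exact h3 i hi
    · obtain ⟨y, h1, h2, h3⟩ := key g hg.ne'
      refine ⟨y, fun i _ => ?_⟩
      by_cases hi : i = i₀
      · subst hi
        exact ⟨fun _ => h1.2 hg, fun h => absurd (Finset.mem_insert_self _ _) h⟩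
      · simpa [hi] using h3 i hi
  · rintro ⟨hi₀, ⟨-, x, hx⟩, ⟨-, y, hy⟩⟩
    have hx0 : φ i₀ x < 0 := (hx i₀ (Finset.mem_univ _)).2 hi₀
    have hy0 : 0 < φ i₀ y := (hy i₀ (Finset.mem_univ _)).1 (Finset.mem_insert_self _ _)
    -- A positive combination of `x` and `y`, proportional to the point where the segment between
    -- them meets the hyperplane.
    refine ⟨fun i hi => Finset.mem_erase.2 ⟨fun h => hi₀ (h ▸ hi), Finset.mem_univ _⟩,
      ⟨φ i₀ y • x - φ i₀ x • y, (hW _).2 (by simp; ring)⟩, fun i hi => ?_⟩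
    have hne := (Finset.mem_erase.1 hi).1
    have h1 := hx i (Finset.mem_univ _)
    have h2 := hy i (Finset.mem_univ _)
    simp only [Finset.mem_insert, hne, false_or] at h2
    simp only [LinearMap.comp_apply, Submodule.subtype_apply, map_sub, map_smul, smul_eq_mul]
    constructor
    · intro his
      nlinarith [mul_pos hy0 (h1.1 his), mul_pos (neg_pos.2 hx0) (h2.1 his)]
    · intro his
      nlinarith [mul_pos hy0 (neg_pos.2 (h1.2 his)),
        mul_pos (neg_pos.2 hx0) (neg_pos.2 (h2.2 his))]

/-- The indices of the hyperplanes carrying a facet of the chamber of `s`. -/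
noncomputable def walls (φ : ι → Module.Dual ℝ V) (s : Finset ι) : Finset ι :=
  open Classical in Finset.univ.filter fun i => symmDiff s {i} ∈ signSets Finset.univ φ

theorem mem_walls {φ : ι → Module.Dual ℝ V} {s : Finset ι} {i : ι} :
    i ∈ walls φ s ↔ symmDiff s {i} ∈ signSets Finset.univ φ := by
  simp [walls]

/-- A vector killed by the forms of all walls of a chamber is killed by all forms. -/
theorem eq_zero_of_forall_mem_walls (φ : ι → Module.Dual ℝ V) (h0 : ∀ i, φ i ≠ 0)
    (hφ : ∀ i k, i ≠ k → ∀ a b : ℝ, a • φ i = b • φ k → a = 0 ∧ b = 0) {s : Finset ι}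
    (hs : s ∈ signSets Finset.univ φ) {z : V} (hz : ∀ i ∈ walls φ s, φ i z = 0) (j : ι) :
    φ j z = 0 := by
  classical
  by_contra hj
  obtain ⟨-, x₀, hx₀⟩ := hs
  -- Walk from a point of the chamber in direction ±z until the first hyperplane is met. It is a
  -- wall whose form does not vanish at z, a contradiction. The quadratic family of extra forms
  -- makes the starting point generic, so that no two hyperplanes are met at the same time.
  let ψ : ι ⊕ ι × ι → Module.Dual ℝ V :=
    Sum.elim φ fun q => φ q.2 z • φ q.1 - φ q.1 z • φ q.2
  obtain ⟨x, hx⟩ := exists_generic_perturbation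
    (Finset.univ.filter fun q => ψ q ≠ 0) ψ (fun q hq => (Finset.mem_filter.1 hq).2) x₀
  have hxs : ∀ i, (i ∈ s → 0 < φ i x) ∧ (i ∉ s → φ i x < 0) := by
    intro i
    have := hx (Sum.inl i) (by simpa [ψ] using h0 i)
    exact ⟨fun h => this.2.1 ((hx₀ i (Finset.mem_univ _)).1 h),
      fun h => this.2.2 ((hx₀ i (Finset.mem_univ _)).2 h)⟩
  have hx0 : ∀ i, φ i x ≠ 0 := by
    intro i
    by_cases h : i ∈ s
    · exact ((hxs i).1 h).ne'
    · exact ((hxs i).2 h).ne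
  have hpair : ∀ i k, i ≠ k → φ i z ≠ 0 → φ k z * φ i x ≠ φ i z * φ k x := by
    intro i k hik hi h
    have := (hx (Sum.inr (i, k)) (by
      simp only [ψ, Sum.elim_inr, Finset.mem_filter, Finset.mem_univ, true_and]
      intro h'
      exact hi (hφ i k hik _ _ (sub_eq_zero.1 h')).2)).1
    apply this
    simp [ψ, h]
  clear hx
  obtain ⟨z', hz', hjz'⟩ : ∃ z', (z' = z ∨ z' = - z) ∧ φ j x * φ j z' < 0 := by
    rcases lt_or_gt_of_ne (mul_ne_zero (hx0 j) hj) with h | h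
    · exact ⟨z, Or.inl rfl, h⟩
    · exact ⟨-z, Or.inr rfl, by simpa using h⟩
  have hpair' : ∀ i k, i ≠ k → φ i z' ≠ 0 → φ k z' * φ i x ≠ φ i z' * φ k x := by
    intro i k hik hi
    rcases hz' with rfl | rfl
    · exact hpair i k hik hi
    · have := hpair i k hik (by simpa using hi)
      simpa using this
  have hzw : ∀ i ∈ walls φ s, φ i z' = 0 := by
    intro i hi
    rcases hz' with rfl | rfl <;> simp [hz i hi]
  -- The hyperplanes met by the ray x + t z', t > 0; the minimized quantity is the time of meeting.
  let P : Finset ι := Finset.univ.filter fun i => φ i x * φ i z' < 0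
  obtain ⟨i₀, hi₀, hmin⟩ := P.exists_min_image (fun i => - (φ i x / φ i z'))
    ⟨j, by simpa [P] using hjz'⟩
  have hP : φ i₀ x * φ i₀ z' < 0 := by simpa [P] using hi₀
  have hi₀z : φ i₀ z' ≠ 0 := fun h => by simp [h] at hP
  set t : ℝ := - (φ i₀ x / φ i₀ z') with ht
  have htz : t * φ i₀ z' = - φ i₀ x := by rw [ht]; field_simp
  have ht0 : 0 < t := by
    have h1 : t * (φ i₀ z' * φ i₀ z') = - (φ i₀ x * φ i₀ z') := by
      linear_combination φ i₀ z' * htz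
    exact pos_of_mul_pos_left (h1 ▸ neg_pos.2 hP) (mul_self_nonneg _)
  have hw : φ i₀ (x + t • z') = 0 := by simp [htz]
  have hne : ∀ k, k ≠ i₀ → φ k x + t * φ k z' ≠ 0 := by
    intro k hk h
    apply hpair' i₀ k hk.symm hi₀z
    linear_combination (φ i₀ z') * h * (-1) + φ k z' * htz
  have hsign : ∀ k, k ≠ i₀ → 0 < φ k x * (φ k x + t * φ k z') := by
    intro k hk
    have h1 : 0 < φ k x * φ k x := mul_self_pos.2 (hx0 k)
    refine lt_of_le_of_ne ?_ (mul_ne_zero (hx0 k) (hne k hk)).symm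
    by_cases hkP : φ k x * φ k z' < 0
    · have hkz : φ k z' ≠ 0 := fun h => by simp [h] at hkP
      have := hmin k (by simpa [P] using hkP)
      have h2 : - (φ k x / φ k z') * (φ k x * φ k z') = - (φ k x * φ k x) := by
        field_simp
      nlinarith
    · nlinarith [mul_nonneg ht0.le (not_lt.1 hkP)]
  -- At the first meeting point only the form of `i₀` vanishes and the others keep their signs, so
  -- this point lies in a chamber of the restriction to `i₀`.
  have hres : s.erase i₀ ∈ signSets (Finset.univ.erase i₀)
      (fun i => (φ i).comp (LinearMap.ker (φ i₀)).subtype) := by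
    refine ⟨Finset.erase_subset_erase _ (Finset.subset_univ _), ⟨x + t • z', hw⟩, fun k hk => ?_⟩
    have hk := (Finset.mem_erase.1 hk).1
    have := hsign k hk
    simp only [LinearMap.comp_apply, Submodule.subtype_apply, map_add, map_smul, smul_eq_mul,
      Finset.mem_erase, hk, ne_eq, not_false_eq_true, true_and]
    exact ⟨fun h => (pos_iff_pos_of_mul_pos this).1 ((hxs k).1 h),
      fun h => (neg_iff_neg_of_mul_pos this).1 ((hxs k).2 h)⟩
  rw [signSets_restrict φ i₀ (h0 i₀) _ fun y => LinearMap.mem_ker] at hres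
  apply hi₀z
  apply hzw
  rw [mem_walls]
  by_cases h : i₀ ∈ s
  · rw [Finset.symmDiff_singleton_of_mem h]
    exact hres.2.1
  · rw [Finset.symmDiff_singleton_of_notMem h]
    simpa [Finset.erase_eq_of_notMem h] using hres.2.2

/-- Every chamber of an essential arrangement has at least as many walls as the dimension. -/
theorem finrank_le_card_walls [FiniteDimensional ℝ V] (φ : ι → Module.Dual ℝ V)
    (h0 : ∀ i, φ i ≠ 0)
    (hφ : ∀ i k, i ≠ k → ∀ a b : ℝ, a • φ i = b • φ k → a = 0 ∧ b = 0)
    (hess : ∀ z, (∀ i, φ i z = 0) → z = 0) {s : Finset ι}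
    (hs : s ∈ signSets Finset.univ φ) : Module.finrank ℝ V ≤ (walls φ s).card := by
  let f : V →ₗ[ℝ] (walls φ s → ℝ) := LinearMap.pi fun i => φ i
  have hf : Function.Injective f := by
    rw [← LinearMap.ker_eq_bot, LinearMap.ker_eq_bot']
    intro z hz
    refine hess z fun j => eq_zero_of_forall_mem_walls φ h0 hφ hs (fun i hi => ?_) j
    exact congrFun hz ⟨i, hi⟩
  simpa using LinearMap.finrank_le_finrank_of_injective hf

/-- Counting the walls of all chambers hyperplane by hyperplane. -/
theorem sum_card_walls (φ : ι → Module.Dual ℝ V) (𝒜 : Finset (Finset ι))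
    (h𝒜 : ∀ s, s ∈ 𝒜 ↔ s ∈ signSets Finset.univ φ) :
    ∑ s ∈ 𝒜, (walls φ s).card =
      ∑ i, 2 * (𝒜.filter fun s => i ∉ s ∧ insert i s ∈ 𝒜).card := by
  have h1 : ∀ s ∈ 𝒜, (walls φ s).card = ∑ i, if symmDiff s {i} ∈ 𝒜 then 1 else 0 := by
    intro s _
    rw [← Finset.card_filter]
    congr 1
    ext i
    simp [mem_walls, h𝒜]
  rw [Finset.sum_congr rfl h1, Finset.sum_comm]
  refine Finset.sum_congr rfl fun i _ => ?_
  -- Each wall is seen from both of its sides: the chambers with i ∈ s are matched with those with i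
  -- ∉ s by removing i.
  rw [← Finset.card_filter, two_mul,
    ← Finset.card_filter_add_card_filter_not (s := 𝒜.filter fun s => symmDiff s {i} ∈ 𝒜)
      (fun s => i ∉ s), Finset.filter_filter, Finset.filter_filter]
  congr 1
  · congr 1
    refine Finset.filter_congr fun s _ => ?_
    constructor
    · rintro ⟨h1, h2⟩
      exact ⟨h2, by rwa [Finset.symmDiff_singleton_of_notMem h2] at h1⟩
    · rintro ⟨h2, h1⟩
      exact ⟨by rwa [Finset.symmDiff_singleton_of_notMem h2], h2⟩
  · refine Finset.card_bij' (fun s _ => s.erase i) (fun s _ => insert i s) ?_ ?_ ?_ ?_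
    · intro s hs
      simp only [Finset.mem_filter, not_not] at hs ⊢
      obtain ⟨h1, h2, h3⟩ := hs
      rw [Finset.symmDiff_singleton_of_mem h3] at h2
      exact ⟨h2, Finset.notMem_erase _ _, by rwa [Finset.insert_erase h3]⟩
    · intro s hs
      simp only [Finset.mem_filter, not_not] at hs ⊢
      obtain ⟨h1, h2, h3⟩ := hs
      refine ⟨h3, ?_, Finset.mem_insert_self _ _⟩
      rw [Finset.symmDiff_singleton_of_mem (Finset.mem_insert_self _ _),
        Finset.erase_insert h2]
      exact h1
    · intro s hs
      exact Finset.insert_erase (by simpa using (Finset.mem_filter.1 hs).2.2)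
    · intro s hs
      exact Finset.erase_insert (Finset.mem_filter.1 hs).2.1

end Walls

/-! ### The threshold arrangement and threshold functions -/

/-- The linear form `y ↦ y₀ + x₁ y₁ + ⋯ + xₙ yₙ`. -/
noncomputable def thresholdForm {n : ℕ} (x : Fin n → ℤˣ) : Module.Dual ℝ (Fin (n + 1) → ℝ) :=
  LinearMap.proj 0 + ∑ i, ((x i : ℤ) : ℝ) • LinearMap.proj i.succ

theorem thresholdForm_apply {n : ℕ} (x : Fin n → ℤˣ) (y : Fin (n + 1) → ℝ) :
    thresholdForm x y = y 0 + ∑ i, y i.succ * ((x i : ℤ) : ℝ) := by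
  simp [thresholdForm, mul_comm]

theorem thresholdForm_single_zero {n : ℕ} (x : Fin n → ℤˣ) :
    thresholdForm x (Pi.single 0 1) = 1 := by
  simp [thresholdForm_apply, Fin.succ_ne_zero]

theorem thresholdForm_single_succ {n : ℕ} (x : Fin n → ℤˣ) (i : Fin n) :
    thresholdForm x (Pi.single i.succ 1) = ((x i : ℤ) : ℝ) := by
  simp [thresholdForm_apply, Pi.single_apply, (Fin.succ_ne_zero i).symm]

theorem thresholdForm_ne_zero {n : ℕ} (x : Fin n → ℤˣ) : thresholdForm x ≠ 0 := by
  intro h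
  have := thresholdForm_single_zero x
  simp [h] at this

theorem intUnit_eq_neg_of_ne {a b : ℤˣ} (h : a ≠ b) : b = -a := by
  rcases Int.units_eq_one_or a with rfl | rfl <;> rcases Int.units_eq_one_or b with rfl | rfl <;>
    simp_all

theorem intUnit_cast_ne_zero (a : ℤˣ) : ((a : ℤ) : ℝ) ≠ 0 := by
  rcases Int.units_eq_one_or a with rfl | rfl <;> simp

/-- Evaluation at the first basis vector gives a = b, and at a coordinate where x and y differ a =
-b. -/
theorem thresholdForm_smul_eq_smul {n : ℕ} (x y : Fin n → ℤˣ) (hxy : x ≠ y) (a b : ℝ)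
    (h : a • thresholdForm x = b • thresholdForm y) : a = 0 ∧ b = 0 := by
  have h1 := LinearMap.congr_fun h (Pi.single 0 1)
  simp only [LinearMap.smul_apply, thresholdForm_single_zero, smul_eq_mul, mul_one] at h1
  subst h1
  obtain ⟨i, hi⟩ := Function.ne_iff.1 hxy
  have h2 := LinearMap.congr_fun h (Pi.single i.succ 1)
  simp only [LinearMap.smul_apply, thresholdForm_single_succ, smul_eq_mul,
    intUnit_eq_neg_of_ne hi, Units.val_neg, Int.cast_neg] at h2
  have h3 : a * ((x i : ℤ) : ℝ) = 0 := by linarith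
  have := (mul_eq_zero.1 h3).resolve_right (intUnit_cast_ne_zero _)
  exact ⟨this, this⟩

theorem thresholdForm_update_one {n : ℕ} (i : Fin n) (z : Fin (n + 1) → ℝ) :
    thresholdForm (Function.update 1 i (-1)) z = thresholdForm 1 z - 2 * z i.succ := by
  rw [thresholdForm_apply, thresholdForm_apply, ← Finset.add_sum_erase _ _ (Finset.mem_univ i),
    ← Finset.add_sum_erase _ _ (Finset.mem_univ i)]
  rw [Finset.sum_congr rfl fun j hj => by
    rw [Function.update_of_ne (Finset.mem_erase.1 hj).1]]
  simp only [Function.update_self, Pi.one_apply, Units.val_neg, Units.val_one, Int.cast_neg,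
    Int.cast_one]
  ring

theorem eq_zero_of_forall_thresholdForm {n : ℕ} (z : Fin (n + 1) → ℝ)
    (h : ∀ x : Fin n → ℤˣ, thresholdForm x z = 0) : z = 0 := by
  have hs : ∀ i : Fin n, z i.succ = 0 := by
    intro i
    have h2 := thresholdForm_update_one i z
    rw [h, h] at h2
    linarith
  have h0 := h 1
  rw [thresholdForm_apply, Finset.sum_eq_zero fun i _ => by rw [hs i, zero_mul], add_zero] at h0
  funext i
  exact Fin.cases h0 hs i

/-- The sets of points of the cube where a chamber of the threshold arrangement is positive. -/
noncomputable def thresholdSets (n : ℕ) : Finset (Finset (Fin n → ℤˣ)) :=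
  (Set.toFinite (signSets Finset.univ (thresholdForm (n := n)))).toFinset

theorem mem_thresholdSets {n : ℕ} {s : Finset (Fin n → ℤˣ)} :
    s ∈ thresholdSets n ↔ s ∈ signSets Finset.univ (thresholdForm (n := n)) := by
  simp [thresholdSets]

theorem mem_thresholdSets_iff {n : ℕ} {s : Finset (Fin n → ℤˣ)} :
    s ∈ thresholdSets n ↔
      ∃ y, ∀ x, (x ∈ s → 0 < thresholdForm x y) ∧ (x ∉ s → thresholdForm x y < 0) := by
  simp [mem_thresholdSets, signSets]

theorem normalHyperplane_cons {n : ℕ} (x : Fin n → ℤˣ) :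
    LinearMap.ker (thresholdForm x) =
      normalHyperplane (Fin.cons 1 fun i => ((x i : ℤ) : ℝ) : Fin (n + 1) → ℝ) := by
  ext y
  change thresholdForm x y = 0 ↔ y ⬝ᵥ _ = 0
  rw [thresholdForm_apply, dotProduct, Fin.sum_univ_succ]
  simp

theorem normalHyperplane_neg {ι : Type*} [Fintype ι] (v : ι → ℝ) :
    normalHyperplane (-v) = normalHyperplane v := by
  ext y
  change y ⬝ᵥ (-v) = 0 ↔ y ⬝ᵥ v = 0
  simp

/-- A hyperplane of the arrangement has the two sign normals ±v; exactly one of them has first entry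
1. -/
theorem thresholdArrangement_eq (n : ℕ) : thresholdArrangement (n + 1) =
    (fun x => LinearMap.ker (thresholdForm x)) ''
      ((Finset.univ : Finset (Fin n → ℤˣ)) : Set (Fin n → ℤˣ)) := by
  have key : ∀ v : Fin (n + 1) → ℝ, (∀ i, v i = 1 ∨ v i = -1) → v 0 = 1 →
      ∃ x : Fin n → ℤˣ, v = Fin.cons 1 fun i => ((x i : ℤ) : ℝ) := by
    intro v hv h0
    refine ⟨fun i => if v i.succ = 1 then 1 else -1, ?_⟩
    funext i
    refine Fin.cases h0 (fun i => ?_) i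
    rcases hv i.succ with h | h <;> norm_num [h]
  ext H
  simp only [Finset.coe_univ, Set.image_univ, Set.mem_range, normalHyperplane_cons]
  constructor
  · rintro ⟨v, hv, rfl⟩
    rcases hv 0 with h0 | h0
    · obtain ⟨x, hx⟩ := key v hv h0
      exact ⟨x, by rw [hx]⟩
    · obtain ⟨x, hx⟩ := key (-v) (fun i => by
        rcases hv i with h | h
        · exact Or.inr (by simp [h])
        · exact Or.inl (by simp [h])) (by simp [h0])
      exact ⟨x, by rw [← hx, normalHyperplane_neg]⟩
  · rintro ⟨x, rfl⟩
    refine ⟨_, fun i => ?_, rfl⟩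
    refine Fin.cases (Or.inl rfl) (fun i => ?_) i
    rcases Int.units_eq_one_or (x i) with h | h <;> simp [h]

theorem numThreshold_eq_card (n : ℕ) : numThreshold n = (thresholdSets n).card := by
  rw [numThreshold, thresholdArrangement_eq, numChambers_eq_ncard_signSets _ _
    fun x => LinearMap.continuous_of_finiteDimensional _, thresholdSets,
    Set.ncard_eq_toFinset_card]

/-- The number of chambers of the threshold arrangement is the number of threshold functions. -/
theorem numThreshold_eq_card_thresholdFunction (n : ℕ) :
    numThreshold n = Nat.card {f : (Fin n → ℤˣ) → ℤˣ // IsThresholdFunction f} := by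
  have hval : ∀ (f : (Fin n → ℤˣ) → ℤˣ) (t : ℝ) (a : Fin n → ℝ), (∀ x : Fin n → ℤˣ,
      f x = if 0 ≤ t + ∑ i, a i * ((x i : ℤ) : ℝ) then 1 else -1) ↔
      ∀ x, f x = if 0 ≤ thresholdForm x (Fin.cons t a : Fin (n + 1) → ℝ) then 1 else -1 := by
    intro f t a
    simp [thresholdForm_apply]
  have hmem : ∀ f : {f : (Fin n → ℤˣ) → ℤˣ // IsThresholdFunction f},
      Finset.univ.filter (fun x => f.1 x = 1) ∈ thresholdSets n := by
    rintro ⟨f, t, a, hf⟩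
    rw [hval] at hf
    rw [mem_thresholdSets_iff]
    -- The affine function may vanish on the cube, where sgn is 1 by convention; raising the
    -- threshold slightly makes these values positive and changes no other sign.
    obtain ⟨ε, hε, h⟩ := exists_pos_perturbation Finset.univ (thresholdForm (n := n))
      (Fin.cons t a : Fin (n + 1) → ℝ) (Pi.single 0 1)
    refine ⟨(Fin.cons t a : Fin (n + 1) → ℝ) + ε • Pi.single 0 1, fun x => ?_⟩
    obtain ⟨h1, h2, h3⟩ := h x (Finset.mem_univ _)
    simp only [Finset.mem_filter, Finset.mem_univ, true_and, hf x]
    constructor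
    · intro hx
      have hx' : 0 ≤ thresholdForm x (Fin.cons t a : Fin (n + 1) → ℝ) := by
        by_contra hneg
        simp [hneg] at hx
      rcases hx'.lt_or_eq with h' | h'
      · exact h1 h'
      · rw [h3 h'.symm, thresholdForm_single_zero, mul_one]
        exact hε
    · intro hx
      apply h2
      by_contra hneg
      simp [not_lt.1 hneg] at hx
  rw [numThreshold_eq_card, ← Fintype.card_coe, ← Nat.card_eq_fintype_card]
  refine (Nat.card_eq_of_bijective (fun f => ⟨_, hmem f⟩) ⟨?_, ?_⟩).symm
  · intro f g hfg
    have hfg' := congrArg Subtype.val hfg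
    refine Subtype.ext (funext fun x => ?_)
    have hx := Finset.ext_iff.1 hfg' x
    simp only [Finset.mem_filter, Finset.mem_univ, true_and] at hx
    rcases Int.units_eq_one_or (f.1 x) with h | h
    · rw [h, hx.1 h]
    · rcases Int.units_eq_one_or (g.1 x) with h' | h'
      · rw [h', hx.2 h']
      · rw [h, h']
  · rintro ⟨s, hs⟩
    obtain ⟨y, hy⟩ := mem_thresholdSets_iff.1 hs
    refine ⟨⟨fun x => if x ∈ s then 1 else -1, y 0, Fin.tail y, ?_⟩, ?_⟩
    · rw [hval, Fin.cons_self_tail]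
      intro x
      by_cases hx : x ∈ s
      · simp [hx, ((hy x).1 hx).le]
      · simp [hx, (hy x).2 hx]
    · refine Subtype.ext (Finset.ext fun x => ?_)
      by_cases hx : x ∈ s <;> simp [hx]

/-! ### The resonance arrangement as a restriction -/

/-- On zero-sum vectors the form of x equals -2 times the coordinate sum over S = {i : x_i = -1}. As
S and its complement give the same hyperplane, S may be assumed to avoid 0; then S is nonempty
exactly when x ≠ 1. -/
theorem resonanceArrangement_eq (n : ℕ) : resonanceArrangement n =
    (fun x => LinearMap.ker ((thresholdForm x).comp (zeroSumSpace (n + 1)).subtype)) ''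
      (((Finset.univ : Finset (Fin n → ℤˣ)).erase 1 : Finset _) : Set (Fin n → ℤˣ)) := by
  have key : ∀ (S : Finset (Fin (n + 1))) (x : Fin n → ℤˣ), 0 ∉ S →
      (∀ i, x i = if i.succ ∈ S then -1 else 1) →
      (normalHyperplane (indicatorVector S)).comap (zeroSumSpace (n + 1)).subtype =
      LinearMap.ker ((thresholdForm x).comp (zeroSumSpace (n + 1)).subtype) := by
    intro S x h0 hx
    ext ⟨y, hy⟩
    replace hy : y ⬝ᵥ (fun _ => 1) = 0 := hy
    change y ⬝ᵥ indicatorVector S = 0 ↔ thresholdForm x y = 0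
    have : thresholdForm x y = y ⬝ᵥ (fun _ => 1) - 2 * (y ⬝ᵥ indicatorVector S) := by
      rw [thresholdForm_apply, dotProduct, dotProduct, Fin.sum_univ_succ, Fin.sum_univ_succ,
        indicatorVector, if_neg h0, mul_zero, zero_add, mul_one, Finset.mul_sum, add_sub_assoc,
        ← Finset.sum_sub_distrib]
      congr 1
      refine Finset.sum_congr rfl fun i _ => ?_
      rw [hx]
      simp only [indicatorVector]
      split_ifs <;> simp
      ring
    rw [this, hy]
    simp
  ext H
  simp only [Set.mem_image, Finset.mem_coe, Finset.mem_erase, Finset.mem_univ, and_true]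
  constructor
  · rintro ⟨S, hS, hS', rfl⟩
    wlog h0 : 0 ∉ S generalizing S
    · obtain ⟨x, hx, h⟩ := this Sᶜ (by
        rw [Finset.nonempty_iff_ne_empty]
        simpa using hS') (by
        rw [Ne, Finset.compl_eq_univ_iff]
        exact hS.ne_empty) (by simpa using h0)
      refine ⟨x, hx, h.trans ?_⟩
      ext ⟨y, hy⟩
      replace hy : y ⬝ᵥ (fun _ => 1) = 0 := hy
      change y ⬝ᵥ indicatorVector Sᶜ = 0 ↔ y ⬝ᵥ indicatorVector S = 0
      have : indicatorVector Sᶜ = (fun _ => 1) - indicatorVector S := by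
        funext i
        by_cases h : i ∈ S <;> simp [indicatorVector, h]
      rw [this, dotProduct_sub, hy]
      simp
    · refine ⟨fun i => if i.succ ∈ S then -1 else 1, fun h => ?_, (key S _ h0 fun i => rfl).symm⟩
      obtain ⟨i, hi⟩ := hS
      obtain ⟨j, rfl⟩ := Fin.exists_succ_eq.2 (fun h => h0 (h ▸ hi) : i ≠ 0)
      have := congrFun h j
      simp [hi] at this
  · rintro ⟨x, hx, rfl⟩
    obtain ⟨i, hi⟩ := Function.ne_iff.1 hx
    have h0 : (0 : Fin (n + 1)) ∉ Finset.univ.filter fun j => ∃ i : Fin n, i.succ = j ∧ x i = -1 := by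
      simp [Fin.succ_ne_zero]
    refine ⟨Finset.univ.filter fun j => ∃ i : Fin n, i.succ = j ∧ x i = -1, ⟨i.succ, ?_⟩, ?_,
      (key _ x h0 fun i => ?_).symm⟩
    · simpa using intUnit_eq_neg_of_ne hi.symm
    · intro h
      exact h0 (by rw [h]; exact Finset.mem_univ _)
    · rcases Int.units_eq_one_or (x i) with h | h <;> simp [h]

/-- The zero-sum space is the kernel of the form of the all-ones point, so `signSets_restrict`
applies. -/
theorem numResonance_eq_card (n : ℕ) : numResonance n =
    ((thresholdSets n).filter fun s => 1 ∉ s ∧ insert 1 s ∈ thresholdSets n).card := by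
  rw [numResonance, resonanceArrangement_eq, numChambers_eq_ncard_signSets _ _
    fun x => LinearMap.continuous_of_finiteDimensional _,
    signSets_restrict thresholdForm 1 (thresholdForm_ne_zero 1)]
  · rw [← Set.ncard_coe_finset]
    congr 1
    ext s
    simp only [Finset.coe_filter, Set.mem_ofPred_eq, mem_thresholdSets]
    tauto
  · intro y
    change y ⬝ᵥ (fun _ => 1) = 0 ↔ _
    rw [thresholdForm_apply, dotProduct, Fin.sum_univ_succ]
    simp

/-! ### Comparison of R_n with T_n -/

theorem thresholdForm_mul {n : ℕ} (x x₀ : Fin n → ℤˣ) (y : Fin (n + 1) → ℝ) :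
    thresholdForm x (Fin.cons (y 0) fun i => y i.succ * ((x₀ i : ℤ) : ℝ) : Fin (n + 1) → ℝ) =
      thresholdForm (x * x₀) y := by
  simp only [thresholdForm_apply, Fin.cons_zero, Fin.cons_succ, Pi.mul_apply, Units.val_mul,
    Int.cast_mul]
  congr 1
  exact Finset.sum_congr rfl fun i _ => by ring

theorem map_mulRight_mem_thresholdSets {n : ℕ} (x₀ : Fin n → ℤˣ) {s : Finset (Fin n → ℤˣ)}
    (hs : s ∈ thresholdSets n) :
    s.map (Equiv.mulRight x₀).toEmbedding ∈ thresholdSets n := by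
  rw [mem_thresholdSets_iff] at hs ⊢
  obtain ⟨y, hy⟩ := hs
  refine ⟨(Fin.cons (y 0) fun i => y i.succ * (((x₀⁻¹) i : ℤ) : ℝ) : Fin (n + 1) → ℝ),
    fun x => ?_⟩
  rw [thresholdForm_mul, Finset.mem_map_equiv]
  exact hy _

theorem compl_mem_thresholdSets {n : ℕ} {s : Finset (Fin n → ℤˣ)} (hs : s ∈ thresholdSets n) :
    sᶜ ∈ thresholdSets n := by
  rw [mem_thresholdSets_iff] at hs ⊢
  obtain ⟨y, hy⟩ := hs
  refine ⟨-y, fun x => ?_⟩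
  simpa using (hy x).symm

/-- Multiplication by x₀ on the cube permutes the threshold chambers and carries the hyperplane of 1
to that of x₀. -/
theorem card_adjacent_eq_numResonance (n : ℕ) (x₀ : Fin n → ℤˣ) :
    ((thresholdSets n).filter fun s => x₀ ∉ s ∧ insert x₀ s ∈ thresholdSets n).card =
      numResonance n := by
  rw [numResonance_eq_card]
  have h : ∀ x y z : Fin n → ℤˣ, x * z = y → ∀ s ∈ (thresholdSets n).filter
      (fun s => x ∉ s ∧ insert x s ∈ thresholdSets n),
      s.map (Equiv.mulRight z).toEmbedding ∈ (thresholdSets n).filter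
        (fun s => y ∉ s ∧ insert y s ∈ thresholdSets n) := by
    rintro x y z rfl s hs
    simp only [Finset.mem_filter] at hs ⊢
    refine ⟨map_mulRight_mem_thresholdSets z hs.1, ?_, ?_⟩
    · simpa [Finset.mem_map_equiv] using hs.2.1
    · simpa [Finset.map_insert] using map_mulRight_mem_thresholdSets z hs.2.2
  refine Finset.card_bij' _ _ (h x₀ 1 x₀⁻¹ (mul_inv_cancel _)) (h 1 x₀ x₀ (one_mul _)) ?_ ?_
  · intro s _
    ext x
    simp
  · intro s _
    ext x
    simp

/-- In the chamber of the points whose coordinate `0` is positive and exceeds the sum of the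
absolute values of the others, every hyperplane carries a facet. -/
theorem exists_thresholdSet_walls_eq_univ (n : ℕ) (hn : 1 ≤ n) :
    ∃ s ∈ thresholdSets n, walls (thresholdForm (n := n)) s = Finset.univ := by
  refine ⟨Finset.univ, mem_thresholdSets_iff.2 ⟨Pi.single 0 1, fun x => ?_⟩, ?_⟩
  · simp [thresholdForm_single_zero]
  · refine Finset.eq_univ_of_forall fun w => ?_
    rw [mem_walls, Finset.symmDiff_singleton_of_mem (Finset.mem_univ w), ← mem_thresholdSets,
      mem_thresholdSets_iff]
    -- The form of x at this point is n - 1 - ⟨w, x⟩: it is -1 at x = w and at least 1 elsewhere,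
    -- since a single disagreement lowers ⟨w, x⟩ to n - 2.
    refine ⟨(Fin.cons (n - 1) fun i => - ((w i : ℤ) : ℝ) : Fin (n + 1) → ℝ), fun x => ?_⟩
    simp only [Finset.mem_erase, Finset.mem_univ, and_true, not_not, thresholdForm_apply,
      Fin.cons_zero, Fin.cons_succ]
    constructor
    · intro hx
      obtain ⟨i, hi⟩ := Function.ne_iff.1 hx
      rw [← Finset.add_sum_erase _ _ (Finset.mem_univ i), intUnit_eq_neg_of_ne hi]
      have h1 : ∀ j ∈ (Finset.univ : Finset (Fin n)).erase i,
          (-1 : ℝ) ≤ - ((w j : ℤ) : ℝ) * ((x j : ℤ) : ℝ) := by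
        intro j _
        rcases Int.units_eq_one_or (x j) with h | h <;>
          rcases Int.units_eq_one_or (w j) with h' | h' <;> simp [h, h']
      have h2 := Finset.card_nsmul_le_sum _ _ _ h1
      rw [Finset.card_erase_of_mem (Finset.mem_univ i), Finset.card_univ, Fintype.card_fin,
        nsmul_eq_mul, Nat.cast_sub hn] at h2
      have h3 : - (((-x i : ℤˣ) : ℤ) : ℝ) * ((x i : ℤ) : ℝ) = 1 := by
        rcases Int.units_eq_one_or (x i) with h | h <;> simp [h]
      push_cast at h2 h3 ⊢
      linarith
    · rintro rfl
      have h1 : ∀ j, - ((x j : ℤ) : ℝ) * ((x j : ℤ) : ℝ) = -1 := by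
        intro j
        rcases Int.units_eq_one_or (x j) with h | h <;> simp [h]
      simp [h1]

/-- Double counting of (chamber, wall): each of the 2^n hyperplanes contributes 2 R_n, each chamber
at least n + 1. Strictness comes from a chamber with 2^n walls. -/
theorem lt_numResonance (n : ℕ) (hn : 2 ≤ n) :
    (n + 1) * numThreshold n < 2 ^ (n + 1) * numResonance n := by
  have h1 := sum_card_walls thresholdForm (thresholdSets n) fun s => mem_thresholdSets
  simp only [card_adjacent_eq_numResonance, Finset.sum_const, Finset.card_univ, Fintype.card_fun,
    Fintype.card_units_int, Fintype.card_fin, smul_eq_mul] at h1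
  obtain ⟨s₀, hs₀, hw⟩ := exists_thresholdSet_walls_eq_univ n (by omega)
  have h2 : ∑ _s ∈ thresholdSets n, (n + 1) <
      ∑ s ∈ thresholdSets n, (walls (thresholdForm (n := n)) s).card := by
    refine Finset.sum_lt_sum (fun s hs => ?_) ⟨s₀, hs₀, ?_⟩
    · simpa using finrank_le_card_walls thresholdForm thresholdForm_ne_zero
        thresholdForm_smul_eq_smul eq_zero_of_forall_thresholdForm (mem_thresholdSets.1 hs)
    · rw [hw, Finset.card_univ, Fintype.card_fun, Fintype.card_units_int, Fintype.card_fin]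
      clear * - hn
      induction n, hn using Nat.le_induction with
      | base => norm_num
      | succ k _ ih => rw [pow_succ]; omega
  rw [Finset.sum_const, smul_eq_mul, ← numThreshold_eq_card, h1] at h2
  rw [pow_succ]
  linarith

/-- Taking complements shows that half of the chambers are negative at 1, and R_n counts those among
them having the hyperplane of 1 as a wall. A chamber near (-1, …, -1) is negative at 1 but lacks
this wall. -/
theorem two_mul_numResonance_lt (n : ℕ) (hn : 2 ≤ n) :
    2 * numResonance n < numThreshold n := by
  have h1 : 2 * ((thresholdSets n).filter fun s => 1 ∉ s).card = numThreshold n := by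
    rw [numThreshold_eq_card, two_mul,
      ← Finset.card_filter_add_card_filter_not (s := thresholdSets n) (fun s => 1 ∉ s)]
    congr 1
    refine Finset.card_bij' (fun s _ => sᶜ) (fun s _ => sᶜ) ?_ ?_ (fun s _ => compl_compl s)
      (fun s _ => compl_compl s)
    · intro s hs
      simp only [Finset.mem_filter] at hs ⊢
      exact ⟨compl_mem_thresholdSets hs.1, by simpa using hs.2⟩
    · intro s hs
      simp only [Finset.mem_filter] at hs ⊢
      exact ⟨compl_mem_thresholdSets hs.1, by simpa using hs.2⟩
  rw [← h1]
  refine Nat.mul_lt_mul_of_pos_left ?_ two_pos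
  rw [numResonance_eq_card]
  obtain ⟨y, hy⟩ := exists_generic_perturbation Finset.univ (thresholdForm (n := n))
    (fun x _ => thresholdForm_ne_zero x) (fun _ => -1)
  let s : Finset (Fin n → ℤˣ) := Finset.univ.filter fun x => 0 < thresholdForm x y
  have hys : ∀ x, (x ∈ s → 0 < thresholdForm x y) ∧ (x ∉ s → thresholdForm x y < 0) := by
    intro x
    refine ⟨fun h => (Finset.mem_filter.1 h).2, fun h => lt_of_le_of_ne (not_lt.1 fun h' => ?_)
      (hy x (Finset.mem_univ _)).1⟩
    exact h (Finset.mem_filter.2 ⟨Finset.mem_univ _, h'⟩)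
  have hs : s ∈ thresholdSets n := mem_thresholdSets_iff.2 ⟨y, hys⟩
  have hn' : (2 : ℝ) ≤ n := by exact_mod_cast hn
  have hsum : ∀ x : Fin n → ℤˣ, thresholdForm x (fun _ => (-1 : ℝ)) =
      -1 - ∑ i, ((x i : ℤ) : ℝ) := by
    intro x
    simp [thresholdForm_apply, sub_eq_add_neg]
  have hneg : ∀ x, thresholdForm x (fun _ => (-1 : ℝ)) < 0 → x ∉ s := by
    intro x hx h
    exact absurd ((hys x).1 h) (not_lt.2 ((hy x (Finset.mem_univ _)).2.2 hx).le)
  have h1s : 1 ∉ s := hneg 1 (by rw [hsum]; simp; linarith)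
  let u : Fin n → Fin n → ℤˣ := fun i => Function.update 1 i (-1)
  have hu : ∀ (i : Fin n) (z : Fin (n + 1) → ℝ),
      thresholdForm (u i) z = thresholdForm 1 z - 2 * z i.succ := thresholdForm_update_one
  have hneg1 : ∀ z : Fin (n + 1) → ℝ,
      thresholdForm (-1) z = 2 * z 0 - thresholdForm 1 z := by
    intro z
    simp only [thresholdForm_apply, Pi.neg_apply, Pi.one_apply, Units.val_neg, Units.val_one,
      Int.cast_neg, Int.cast_one, mul_neg, mul_one, Finset.sum_neg_distrib]
    ring
  have hus : ∀ i, u i ∉ s := fun i => hneg _ (by rw [hu, hsum]; simp; linarith)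
  have hone : (-1 : Fin n → ℤˣ) ∈ s := by
    by_contra h
    have h2 := (hy (-1) (Finset.mem_univ _)).2.1 (by rw [hneg1, hsum]; simp; linarith)
    exact absurd h2 (not_lt.2 ((hys _).2 h).le)
  refine Finset.card_lt_card (Finset.ssubset_iff_of_subset ?_ |>.2 ⟨s, ?_, fun h => ?_⟩)
  · exact Finset.monotone_filter_right _ fun s _ hs => hs.1
  · exact Finset.mem_filter.2 ⟨hs, h1s⟩
  · obtain ⟨z, hz⟩ := mem_thresholdSets_iff.1 (Finset.mem_filter.1 h).2.2
    have hz1 := (hz 1).1 (Finset.mem_insert_self _ _)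
    have hz2 := (hz (-1)).1 (Finset.mem_insert_of_mem hone)
    have hz3 : ∀ i, thresholdForm (u i) z < 0 := by
      intro i
      refine (hz _).2 fun h => ?_
      rcases Finset.mem_insert.1 h with h | h
      · have := congrFun h i
        simp [u] at this
      · exact hus i h
    -- The forms satisfy ∑ᵢ f(uᵢ) = (n - 1) f(1) + f(-1). Crossing only the hyperplane of 1 would
    -- make the right side positive and every term on the left negative.
    have hz4 := Finset.sum_nonpos fun i (_ : i ∈ Finset.univ) => (hz3 i).le
    simp only [hu, Finset.sum_sub_distrib, Finset.sum_const, Finset.card_univ, Fintype.card_fin,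
      nsmul_eq_mul, ← Finset.mul_sum] at hz4
    have hz5 : thresholdForm 1 z = z 0 + ∑ i : Fin n, z i.succ := by
      simp [thresholdForm_apply]
    rw [hneg1] at hz2
    nlinarith

/-! ### Shattering bounds for T_n -/

/-- A family of sets contains at least as many sets as it strongly shatters. -/
theorem Finset.card_le_card_of_stronglyShatters {α : Type*} [Fintype α] [DecidableEq α]
    (𝒜 𝒢 : Finset (Finset α))
    (h : ∀ S ∈ 𝒢, ∃ B, Disjoint B S ∧ ∀ A ⊆ S, A ∪ B ∈ 𝒜) : 𝒢.card ≤ 𝒜.card := by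
  -- Duality: if 𝒜 strongly shatters S, then the complementary family does not shatter the
  -- complement of S. Pajor's inequality for that family then bounds the size of 𝒢.
  have h1 : (𝒜ᶜ).card ≤ (𝒜ᶜ).shatterer.card := card_le_card_shatterer _
  have h2 : Disjoint 𝒢 ((𝒜ᶜ).shatterer.image compl) := by
    rw [Finset.disjoint_left]
    intro S hS hS'
    obtain ⟨T, hT, rfl⟩ := Finset.mem_image.1 hS'
    obtain ⟨B, hB, hA⟩ := h _ hS
    obtain ⟨u, hu, huB⟩ := (mem_shatterer.1 hT) (t := B) (by
      rwa [disjoint_compl_right_iff] at hB)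
    refine Finset.mem_compl.1 hu ?_
    have := hA (Tᶜ ∩ u) Finset.inter_subset_left
    rwa [← huB, ← Finset.union_inter_distrib_right, Finset.union_comm, Finset.union_compl,
      Finset.univ_inter] at this
  have h3 := Finset.card_le_univ (𝒢.disjUnion _ h2)
  rw [Finset.card_disjUnion, Finset.card_image_of_injective _ compl_injective] at h3
  have h4 := Finset.card_compl_add_card 𝒜
  omega

/-- The forms of a shattered set are independent: given a nontrivial relation, a chamber whose signs
match those of the coefficients would make a zero combination positive. -/
theorem card_le_of_thresholdSets_shatters {n : ℕ} {s : Finset (Fin n → ℤˣ)}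
    (hs : (thresholdSets n).Shatters s) : s.card ≤ n + 1 := by
  have hli : LinearIndependent ℝ fun x : s => thresholdForm (x : Fin n → ℤˣ) := by
    rw [Fintype.linearIndependent_iff]
    intro c hc
    by_contra! hne
    obtain ⟨j, hj⟩ := hne
    let d : (Fin n → ℤˣ) → ℝ := fun x => if h : x ∈ s then c ⟨x, h⟩ else 0
    obtain ⟨u, hu, hsu⟩ := hs (t := s.filter fun x => 0 < d x) (Finset.filter_subset _ _)
    obtain ⟨y, hy⟩ := mem_thresholdSets_iff.1 hu
    have hd : ∀ x : s, d x = c x := fun x => by simp [d]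
    have hmem : ∀ x : s, (x : Fin n → ℤˣ) ∈ u ↔ 0 < c x := by
      intro x
      have := Finset.ext_iff.1 hsu x
      simpa [hd] using this
    have hterm : ∀ x : s, c x ≠ 0 → 0 < c x * thresholdForm (x : Fin n → ℤˣ) y := by
      intro x hx
      by_cases h : 0 < c x
      · exact mul_pos h ((hy x).1 ((hmem x).2 h))
      · exact mul_pos_of_neg_of_neg (lt_of_le_of_ne (not_lt.1 h) hx)
          ((hy x).2 fun h' => h ((hmem x).1 h'))
    have hpos : 0 < ∑ x : s, c x * thresholdForm (x : Fin n → ℤˣ) y := by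
      refine Finset.sum_pos' (fun x _ => ?_) ⟨j, Finset.mem_univ _, hterm j hj⟩
      by_cases h : c x = 0
      · simp [h]
      · exact (hterm x h).le
    have := LinearMap.congr_fun hc y
    simp only [LinearMap.sum_apply, LinearMap.smul_apply, smul_eq_mul,
      LinearMap.zero_apply] at this
    exact hpos.ne' this
  have := hli.fintype_card_le_finrank
  rwa [Fintype.card_coe, Subspace.dual_finrank_eq, Module.finrank_fin_fun] at this

theorem numThreshold_le_sum_choose (n : ℕ) :
    numThreshold n ≤ ∑ k ∈ Finset.range (n + 2), (2 ^ n).choose k := by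
  rw [numThreshold_eq_card]
  refine (Finset.card_le_card_shatterer _).trans (Finset.card_shatterer_le_sum_vcDim.trans ?_)
  simp only [Fintype.card_fun, Fintype.card_units_int, Fintype.card_fin]
  refine Finset.sum_le_sum_of_subset fun k hk => ?_
  have h : (thresholdSets n).vcDim ≤ n + 1 :=
    Finset.sup_le fun s hs => card_le_of_thresholdSets_shatters (Finset.mem_shatterer.1 hs)
  have := Finset.mem_Iic.1 hk
  exact Finset.mem_range.2 (by omega)

/-- By the span condition, some z lies on the hyperplanes of S and on no others. Perturbing z gives
arbitrary signs on S while those off S stay fixed, so S is strongly shattered. -/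
theorem card_le_numThreshold_of_forall_notMem_span {n : ℕ} (𝒢 : Finset (Finset (Fin n → ℤˣ)))
    (h𝒢 : ∀ S ∈ 𝒢, ∀ x,
      thresholdForm x ∉ Submodule.span ℝ (thresholdForm '' ((S : Set (Fin n → ℤˣ)) \ {x}))) :
    𝒢.card ≤ numThreshold n := by
  rw [numThreshold_eq_card]
  refine Finset.card_le_card_of_stronglyShatters _ _ fun S hS => ?_
  -- For x in S these vectors are dual to the forms up to scaling; for x outside S they show that
  -- the common kernel is not contained in the hyperplane of x.
  have hu : ∀ x, ∃ u, thresholdForm x u ≠ 0 ∧ ∀ y ∈ S, y ≠ x → thresholdForm y u = 0 := by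
    intro x
    by_contra! hcon
    refine h𝒢 S hS x ?_
    have := mem_span_of_iInf_ker_le_ker
      (L := fun y : ((S : Set (Fin n → ℤˣ)) \ {x} : Set _) => thresholdForm (y : Fin n → ℤˣ))
      (K := thresholdForm x) (fun u hu => by
        by_contra hxu
        obtain ⟨y, hy, hyx, hyu⟩ := hcon u hxu
        exact hyu ((Submodule.mem_iInf _).1 hu ⟨y, hy, hyx⟩))
    rwa [Set.image_eq_range]
  choose u hu hu' using hu
  let W : Submodule ℝ (Fin (n + 1) → ℝ) := ⨅ x : S, LinearMap.ker (thresholdForm (x : Fin n → ℤˣ))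
  obtain ⟨⟨z, hzW⟩, hz⟩ := exists_forall_dual_ne_zero Sᶜ
    (fun x => (thresholdForm x).comp W.subtype) (fun x hx h => by
      have hxW : u x ∈ W := (Submodule.mem_iInf _).2 fun y =>
        hu' x y y.2 fun h => Finset.mem_compl.1 hx (h ▸ y.2)
      exact hu x (LinearMap.congr_fun h ⟨u x, hxW⟩))
  have hzS : ∀ x ∈ S, thresholdForm x z = 0 := fun x hx => (Submodule.mem_iInf _).1 hzW ⟨x, hx⟩
  replace hz : ∀ x ∉ S, thresholdForm x z ≠ 0 := fun x hx => hz x (Finset.mem_compl.2 hx)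
  refine ⟨Sᶜ.filter fun x => 0 < thresholdForm x z, ?_, fun A hA => ?_⟩
  · exact Finset.disjoint_left.2 fun x hx => Finset.mem_compl.1 (Finset.mem_filter.1 hx).1
  let g : Fin (n + 1) → ℝ :=
    ∑ x ∈ S, ((if x ∈ A then 1 else -1) * (thresholdForm x (u x))⁻¹) • u x
  have hg : ∀ x ∈ S, thresholdForm x g = if x ∈ A then 1 else -1 := by
    intro x hx
    simp only [g, map_sum, map_smul, smul_eq_mul]
    rw [Finset.sum_eq_single_of_mem x hx fun y _ hyx => by rw [hu' y x hx hyx.symm, mul_zero],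
      mul_assoc, inv_mul_cancel₀ (hu x), mul_one]
  obtain ⟨ε, hε, hy⟩ := exists_pos_perturbation Finset.univ (thresholdForm (n := n)) z g
  refine mem_thresholdSets_iff.2 ⟨z + ε • g, fun x => ?_⟩
  obtain ⟨h1, h2, h3⟩ := hy x (Finset.mem_univ _)
  by_cases hx : x ∈ S
  · rw [h3 (hzS x hx), hg x hx]
    by_cases hxA : x ∈ A <;> simp [hx, hxA, hε]
  · have hxA : x ∉ A := fun h => hx (hA h)
    simp only [Finset.mem_union, hxA, false_or, Finset.mem_filter, Finset.mem_compl, hx,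
      not_false_eq_true, true_and]
    exact ⟨h1, fun h => h2 (lt_of_le_of_ne (not_lt.1 h) (hz x hx))⟩

/-- With N = 2^n and n ≥ 3, the terms k < n contribute at most N^n/7, the term k = n at most N^n/6,
and k = n + 1 at most N^n/3 because (n+1)! ≥ 3N. -/
theorem sum_choose_two_pow_le (n : ℕ) (hn : 2 ≤ n) :
    ∑ k ∈ Finset.range (n + 2), (2 ^ n).choose k ≤ 2 ^ (n ^ 2) := by
  rcases hn.eq_or_lt with rfl | hn
  · decide
  have hgeom : ∀ m : ℕ, 7 * ∑ k ∈ Finset.range m, (2 ^ n) ^ k ≤ (2 ^ n) ^ m := by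
    intro m
    have h8 : 8 ≤ 2 ^ n := by
      calc 8 = 2 ^ 3 := by norm_num
        _ ≤ 2 ^ n := Nat.pow_le_pow_right two_pos hn
    induction m with
    | zero => simp
    | succ m ih =>
      rw [Finset.sum_range_succ, pow_succ]
      nlinarith [Nat.pow_pos (n := m) (Nat.two_pow_pos n)]
  have hfac : 3 * 2 ^ n ≤ (n + 1).factorial := by
    clear * - hn
    induction n, hn using Nat.le_induction with
    | base => decide
    | succ k hk ih =>
      rw [Nat.factorial_succ, pow_succ]
      nlinarith [Nat.two_pow_pos k]
  have hchoose : ∀ k, k.factorial * (2 ^ n).choose k ≤ (2 ^ n) ^ k := by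
    intro k
    rw [← Nat.descFactorial_eq_factorial_mul_choose]
    exact Nat.descFactorial_le_pow _ _
  have h1 : ∑ k ∈ Finset.range n, (2 ^ n).choose k ≤ ∑ k ∈ Finset.range n, (2 ^ n) ^ k :=
    Finset.sum_le_sum fun k _ => Nat.choose_le_pow _ _
  have h2 : 6 * (2 ^ n).choose n ≤ (2 ^ n) ^ n :=
    (Nat.mul_le_mul_right _ (Nat.factorial_le (n := n) hn : Nat.factorial 3 ≤ _)).trans (hchoose n)
  have h3 : 3 * (2 ^ n).choose (n + 1) ≤ (2 ^ n) ^ n := by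
    have := (Nat.mul_le_mul_right _ hfac).trans (hchoose (n + 1))
    rw [pow_succ] at this
    have hp : 0 < 2 ^ n := Nat.two_pow_pos n
    nlinarith
  have h4 := hgeom n
  rw [Finset.sum_range_succ, Finset.sum_range_succ, pow_two n, pow_mul]
  omega

/-! ### Littlewood–Offord bounds for sign matrices -/

/-- **Littlewood–Offord**: a signed sum of nonzero reals takes any given value for at most
`n.choose (n / 2)` choices of the signs. -/
theorem card_signedSum_eq_le_choose {α : Type*} [Fintype α] [DecidableEq α] (a : α → ℝ)
    (ha : ∀ i, a i ≠ 0) (c : ℝ) :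
    (Finset.univ.filter fun ρ : α → ℤˣ => ∑ i, a i * ((ρ i : ℤ) : ℝ) = c).card ≤
      (Fintype.card α).choose (Fintype.card α / 2) := by
  -- Record where the summands are positive. Inclusion of these sets makes the sums comparable term
  -- by term, so solutions with equal sums give an antichain and Sperner applies.
  let f : (α → ℤˣ) → Finset α := fun ρ => Finset.univ.filter fun i => 0 < a i * ((ρ i : ℤ) : ℝ)
  have hle : ∀ ρ σ : α → ℤˣ, f ρ ⊆ f σ → ∀ i, a i * ((ρ i : ℤ) : ℝ) ≤ a i * ((σ i : ℤ) : ℝ) := by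
    intro ρ σ h i
    have hi : 0 < a i * ((ρ i : ℤ) : ℝ) → 0 < a i * ((σ i : ℤ) : ℝ) := fun h' =>
      (Finset.mem_filter.1 (h (Finset.mem_filter.2 ⟨Finset.mem_univ i, h'⟩))).2
    rcases Int.units_eq_one_or (ρ i) with h1 | h1 <;> rcases Int.units_eq_one_or (σ i) with h2 | h2 <;>
      simp only [h1, h2, Units.val_one, Units.val_neg, Int.cast_one, Int.cast_neg, mul_one,
        mul_neg, le_refl] at hi ⊢
    · by_contra h3
      have := hi (by linarith)
      linarith
    · by_contra h3
      have := hi (by linarith)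
      linarith
  have hinj : ∀ ρ σ : α → ℤˣ, (∀ i, a i * ((ρ i : ℤ) : ℝ) = a i * ((σ i : ℤ) : ℝ)) → ρ = σ := by
    intro ρ σ h
    funext i
    have := mul_left_cancel₀ (ha i) (h i)
    exact_mod_cast this
  rw [← Finset.card_image_of_injective (f := f) _ fun ρ σ h => hinj ρ σ fun i =>
    le_antisymm (hle ρ σ h.subset i) (hle σ ρ h.superset i)]
  refine IsAntichain.sperner ?_
  intro A hA B hB hAB hsub
  obtain ⟨ρ, hρ, rfl⟩ := Finset.mem_image.1 hA
  obtain ⟨σ, hσ, rfl⟩ := Finset.mem_image.1 hB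
  have hsum := ((Finset.mem_filter.1 hρ).2).trans (Finset.mem_filter.1 hσ).2.symm
  have := (Finset.sum_eq_sum_iff_of_le fun i _ => hle ρ σ hsub i).1 hsum
  exact hAB (congrArg f (hinj ρ σ fun i => this i (Finset.mem_univ i)))

/-- The signs outside I are free. -/
theorem card_partialSignedSum_eq_le {α : Type*} [Fintype α] [DecidableEq α] (I : Finset α)
    (a : α → ℝ) (ha : ∀ i ∈ I, a i ≠ 0) (c : ℝ) :
    (Finset.univ.filter fun ρ : α → ℤˣ => ∑ i ∈ I, a i * ((ρ i : ℤ) : ℝ) = c).card * 2 ^ I.card ≤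
      I.card.choose (I.card / 2) * 2 ^ Fintype.card α := by
  have h1 := card_signedSum_eq_le_choose (fun i : I => a i) (fun i => ha i i.2) c
  rw [Fintype.card_coe] at h1
  have h2 : (Finset.univ.filter fun ρ : α → ℤˣ => ∑ i ∈ I, a i * ((ρ i : ℤ) : ℝ) = c).card =
      (Finset.univ.filter fun ρ : I → ℤˣ => ∑ i : I, a i * ((ρ i : ℤ) : ℝ) = c).card *
        2 ^ (Fintype.card α - I.card) := by
    have h3 : 2 ^ (Fintype.card α - I.card) =
        (Finset.univ : Finset ({i // i ∉ I} → ℤˣ)).card := by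
      simp [Finset.card_univ, Fintype.card_subtype_compl]
    rw [h3, ← Finset.card_product]
    refine Finset.card_equiv (Equiv.piEquivPiSubtypeProd (fun i => i ∈ I) fun _ => ℤˣ) ?_
    intro ρ
    rw [Finset.mem_filter, Finset.mem_product, Finset.mem_filter, ← Finset.sum_attach I]
    simp only [Finset.mem_univ, true_and, and_true]
    rfl
  have h4 : 2 ^ (Fintype.card α - I.card) * 2 ^ I.card = 2 ^ Fintype.card α := by
    rw [← pow_add, Nat.sub_add_cancel (Finset.card_le_univ I)]
  rw [h2, mul_assoc, h4]
  exact Nat.mul_le_mul_right _ h1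

/-- Twice the largest probability of a value of a sum of `r` random signs: a bound on the
probability that a signed sum of `r` nonzero reals is `1` or `-1`. -/
noncomputable def offordBound (r : ℕ) : ℝ := 2 * r.choose (r / 2) / 2 ^ r

theorem offordBound_nonneg (r : ℕ) : 0 ≤ offordBound r := by
  rw [offordBound]
  positivity

theorem card_partialSignedSum_eq_one_or_le {α : Type*} [Fintype α] [DecidableEq α] (I : Finset α)
    (a : α → ℝ) (ha : ∀ i ∈ I, a i ≠ 0) :
    ((Finset.univ.filter fun ρ : α → ℤˣ => ∑ i ∈ I, a i * ((ρ i : ℤ) : ℝ) = 1 ∨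
      ∑ i ∈ I, a i * ((ρ i : ℤ) : ℝ) = -1).card : ℝ) ≤
      offordBound I.card * 2 ^ Fintype.card α := by
  have h1 := card_partialSignedSum_eq_le I a ha 1
  have h2 := card_partialSignedSum_eq_le I a ha (-1)
  rw [Finset.filter_or]
  have h3 : ((Finset.univ.filter fun ρ : α → ℤˣ => ∑ i ∈ I, a i * ((ρ i : ℤ) : ℝ) = 1) ∪
      (Finset.univ.filter fun ρ : α → ℤˣ => ∑ i ∈ I, a i * ((ρ i : ℤ) : ℝ) = -1)).card *
      2 ^ I.card ≤ 2 * I.card.choose (I.card / 2) * 2 ^ Fintype.card α :=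
    (Nat.mul_le_mul_right _ (Finset.card_union_le _ _)).trans (by linarith)
  rw [offordBound, div_mul_eq_mul_div, le_div_iff₀ (by positivity)]
  exact_mod_cast h3

/-- The number of matrices of signs for which some combination of the columns in `I`, with nonzero
coefficients which are determined by the rows in `J`, is a vector of signs. -/
theorem card_determined_le {α β : Type*} [Fintype α] [DecidableEq α] [Fintype β] [DecidableEq β]
    (I : Finset α) (J : Finset β) (𝒳 : Finset (β → α → ℤˣ))
    (h𝒳 : ∀ X ∈ 𝒳, ∃ a : α → ℝ, (∀ i ∈ I, a i ≠ 0) ∧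
      (∀ j, ∃ e : ℤˣ, ∑ i ∈ I, a i * ((X j i : ℤ) : ℝ) = ((e : ℤ) : ℝ)) ∧
      ∀ b : α → ℝ, (∀ j ∈ J, ∑ i ∈ I, b i * ((X j i : ℤ) : ℝ) = 0) → ∀ i ∈ I, b i = 0) :
    (𝒳.card : ℝ) ≤ 2 ^ (Fintype.card α * Fintype.card β) *
      (2 ^ J.card * offordBound I.card ^ (Fintype.card β - J.card)) := by
  classical
  -- Fix the rows in J and the signs taken there by the combination. This determines the
  -- coefficients on I, so each further row must lie in one Littlewood–Offord set.
  let G : (J → α → ℤˣ) × (J → ℤˣ) → Finset (α → ℤˣ) := fun Yw =>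
    Finset.univ.filter fun ρ => ∃ a : α → ℝ, (∀ i ∈ I, a i ≠ 0) ∧
      (∀ j, ∑ i ∈ I, a i * ((Yw.1 j i : ℤ) : ℝ) = ((Yw.2 j : ℤ) : ℝ)) ∧
      (∀ b : α → ℝ, (∀ j, ∑ i ∈ I, b i * ((Yw.1 j i : ℤ) : ℝ) = 0) → ∀ i ∈ I, b i = 0) ∧
      (∑ i ∈ I, a i * ((ρ i : ℤ) : ℝ) = 1 ∨ ∑ i ∈ I, a i * ((ρ i : ℤ) : ℝ) = -1)
  have hG : ∀ Yw, ((G Yw).card : ℝ) ≤ offordBound I.card * 2 ^ Fintype.card α := by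
    intro Yw
    rcases (G Yw).eq_empty_or_nonempty with h | ⟨ρ₀, hρ₀⟩
    · rw [h, Finset.card_empty, Nat.cast_zero]
      exact mul_nonneg (offordBound_nonneg _) (by positivity)
    · obtain ⟨-, a, ha0, ha, huniq, -⟩ := Finset.mem_filter.1 hρ₀
      refine le_trans (Nat.cast_le.2 (Finset.card_le_card fun ρ hρ => ?_))
        (card_partialSignedSum_eq_one_or_le I a ha0)
      obtain ⟨-, a', -, ha', -, h⟩ := Finset.mem_filter.1 hρ
      have heq : ∀ i ∈ I, a i = a' i := by
        intro i hi
        refine sub_eq_zero.1 (huniq (fun i => a i - a' i) (fun j => ?_) i hi)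
        simp only [sub_mul, Finset.sum_sub_distrib, ha, ha', sub_self]
      have hs : ∑ i ∈ I, a i * ((ρ i : ℤ) : ℝ) = ∑ i ∈ I, a' i * ((ρ i : ℤ) : ℝ) :=
        Finset.sum_congr rfl fun i hi => by rw [heq i hi]
      rw [Finset.mem_filter, hs]
      exact ⟨Finset.mem_univ _, h⟩
  let F : (J → α → ℤˣ) × (J → ℤˣ) → Finset (β → α → ℤˣ) := fun Yw =>
    Fintype.piFinset fun j => if h : j ∈ J then {Yw.1 ⟨j, h⟩} else G Yw
  have hF : ∀ Yw, ((F Yw).card : ℝ) ≤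
      (offordBound I.card * 2 ^ Fintype.card α) ^ (Fintype.card β - J.card) := by
    intro Yw
    have h1 : (F Yw).card = (G Yw).card ^ (Fintype.card β - J.card) := by
      rw [Fintype.card_piFinset, ← Finset.prod_mul_prod_compl J]
      rw [Finset.prod_eq_one fun j hj => by simp [hj], one_mul,
        Finset.prod_congr rfl fun j hj => by rw [dif_neg (Finset.mem_compl.1 hj)],
        Finset.prod_const, Finset.card_compl]
    rw [h1, Nat.cast_pow]
    exact pow_le_pow_left₀ (Nat.cast_nonneg _) (hG Yw) _
  have hsub : 𝒳 ⊆ Finset.univ.biUnion F := by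
    intro X hX
    obtain ⟨a, ha0, ha, huniq⟩ := h𝒳 X hX
    choose e he using ha
    refine Finset.mem_biUnion.2 ⟨(fun j => X j, fun j => e j), Finset.mem_univ _, ?_⟩
    rw [Fintype.mem_piFinset]
    intro j
    by_cases hj : j ∈ J
    · simp [hj]
    · rw [dif_neg hj, Finset.mem_filter]
      refine ⟨Finset.mem_univ _, a, ha0, fun j => he j, fun b hb => huniq b fun j hj =>
        hb ⟨j, hj⟩, ?_⟩
      rw [he j]
      rcases Int.units_eq_one_or (e j) with h | h <;> simp [h]
  have h1 : (𝒳.card : ℝ) ≤ ∑ Yw, ((F Yw).card : ℝ) := by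
    exact_mod_cast (Finset.card_le_card hsub).trans Finset.card_biUnion_le
  refine h1.trans ((Finset.sum_le_sum fun Yw _ => hF Yw).trans (le_of_eq ?_))
  have hJ : Fintype.card α * Fintype.card β =
      Fintype.card α * J.card + Fintype.card α * (Fintype.card β - J.card) := by
    rw [← mul_add, Nat.add_sub_cancel' (Finset.card_le_univ J)]
  simp only [Finset.sum_const, Finset.card_univ, Fintype.card_prod, Fintype.card_fun,
    Fintype.card_units_int, Fintype.card_coe, nsmul_eq_mul, Nat.cast_mul, Nat.cast_pow,
    Nat.cast_ofNat]
  rw [hJ, mul_pow, pow_add, ← pow_mul, ← pow_mul]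
  ring

/-- If the columns in `I` are linearly independent, then some `#I` rows determine the coefficients
of their combinations. -/
theorem exists_card_eq_determining {α β : Type*} [DecidableEq α] [Fintype β] [DecidableEq β]
    (I : Finset α) (x : β → α → ℝ)
    (h : ∀ b : α → ℝ, (∀ j, ∑ i ∈ I, b i * x j i = 0) → ∀ i ∈ I, b i = 0) :
    ∃ J : Finset β, J.card = I.card ∧
      ∀ b : α → ℝ, (∀ j ∈ J, ∑ i ∈ I, b i * x j i = 0) → ∀ i ∈ I, b i = 0 := by
  let v : β → I → ℝ := fun j i => x j i
  -- Row rank equals column rank: independence of the columns in I makes the rows span ℝ^I, and a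
  -- basis is chosen among them.
  have hspan : Submodule.span ℝ (Set.range v) = ⊤ := by
    by_contra hne
    obtain ⟨f, hf, hle⟩ := Submodule.exists_le_ker_of_lt_top _ (lt_top_iff_ne_top.2 hne)
    have hfv : ∀ y : I → ℝ, f y = ∑ i, f (Pi.single i 1) * y i := by
      intro y
      conv_lhs => rw [pi_eq_sum_univ' y]
      simp [map_sum, mul_comm]
    have hb := h (fun i => if hi : i ∈ I then f (Pi.single ⟨i, hi⟩ 1) else 0) fun j => by
      have hj : f (v j) = 0 := hle (Submodule.subset_span ⟨j, rfl⟩)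
      rw [hfv] at hj
      rw [← Finset.sum_attach, ← hj]
      exact Finset.sum_congr rfl fun i _ => by simp [v]
    refine hf (LinearMap.ext fun y => ?_)
    rw [hfv, Finset.sum_eq_zero fun i _ => ?_, LinearMap.zero_apply]
    have := hb i i.2
    simp only [i.2, dite_true] at this
    rw [this, zero_mul]
  obtain ⟨κ, c, hc, hcs, hli⟩ := exists_linearIndependent' ℝ v
  rw [hspan] at hcs
  have : Finite κ := Finite.of_injective c hc
  have : Fintype κ := Fintype.ofFinite κ
  refine ⟨Finset.univ.map ⟨c, hc⟩, ?_, fun b hb i hi => ?_⟩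
  · rw [Finset.card_map, Finset.card_univ,
      ← Module.finrank_eq_card_basis (Module.Basis.mk hli hcs.ge), Module.finrank_fintype_fun_eq_card,
      Fintype.card_coe]
  · let L : Module.Dual ℝ (I → ℝ) := ∑ i : I, b i • LinearMap.proj i
    have hL : ∀ y, L y = ∑ i : I, b i * y i := fun y => by simp [L]
    have hker : (⊤ : Submodule ℝ (I → ℝ)) ≤ LinearMap.ker L := by
      rw [← hcs, Submodule.span_le]
      rintro _ ⟨k, rfl⟩
      have := hb (c k) (by simp)
      rw [← Finset.sum_attach] at this
      change L _ = 0
      rw [hL]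
      exact this
    have := hker (x := Pi.single ⟨i, hi⟩ 1) trivial
    rw [LinearMap.mem_ker, hL] at this
    simpa [Pi.single_apply] using this

/-! ### Generic sign matrices -/

/-- A matrix of signs is exceptional if some combination of at least three linearly independent
columns, with nonzero coefficients, is a vector of signs. -/
def IsExceptional {α β : Type*} (X : β → α → ℤˣ) : Prop :=
  ∃ (I : Finset α) (a : α → ℝ), 3 ≤ I.card ∧ (∀ i ∈ I, a i ≠ 0) ∧
    (∀ j, ∃ e : ℤˣ, ∑ i ∈ I, a i * ((X j i : ℤ) : ℝ) = ((e : ℤ) : ℝ)) ∧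
    ∀ b : α → ℝ, (∀ j, ∑ i ∈ I, b i * ((X j i : ℤ) : ℝ) = 0) → ∀ i ∈ I, b i = 0

/-- Union bound over the set I of columns and a determining set J of rows with as many elements. -/
theorem card_isExceptional_le {α β : Type*} [Fintype α] [DecidableEq α] [Fintype β] [DecidableEq β]
    (𝒳 : Finset (β → α → ℤˣ)) (h𝒳 : ∀ X ∈ 𝒳, IsExceptional X) :
    (𝒳.card : ℝ) ≤ 2 ^ (Fintype.card α * Fintype.card β) *
      ∑ r ∈ Finset.range (Fintype.card α + 1), if 3 ≤ r then
        (Fintype.card α).choose r * (Fintype.card β).choose r *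
          (2 ^ r * offordBound r ^ (Fintype.card β - r)) else 0 := by
  classical
  let N : ℝ := 2 ^ (Fintype.card α * Fintype.card β)
  let g : ℕ → ℝ := fun r => if 3 ≤ r then
    (Fintype.card β).choose r * (2 ^ r * offordBound r ^ (Fintype.card β - r)) else 0
  let D : Finset α → Finset β → Finset (β → α → ℤˣ) := fun I J => 𝒳.filter fun X =>
    ∃ a : α → ℝ, (∀ i ∈ I, a i ≠ 0) ∧
      (∀ j, ∃ e : ℤˣ, ∑ i ∈ I, a i * ((X j i : ℤ) : ℝ) = ((e : ℤ) : ℝ)) ∧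
      ∀ b : α → ℝ, (∀ j ∈ J, ∑ i ∈ I, b i * ((X j i : ℤ) : ℝ) = 0) → ∀ i ∈ I, b i = 0
  let E : Finset α → Finset (β → α → ℤˣ) := fun I =>
    if 3 ≤ I.card then (Finset.univ.powersetCard I.card).biUnion (D I) else ∅
  have hE : ∀ I, ((E I).card : ℝ) ≤ N * g I.card := by
    intro I
    by_cases hI : 3 ≤ I.card
    · simp only [E, g, hI, if_true]
      have h1 : (((Finset.univ.powersetCard I.card).biUnion (D I)).card : ℝ) ≤
          ∑ J ∈ Finset.univ.powersetCard I.card, ((D I J).card : ℝ) := by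
        exact_mod_cast Finset.card_biUnion_le
      refine h1.trans ((Finset.sum_le_sum (g := fun _ =>
        N * (2 ^ I.card * offordBound I.card ^ (Fintype.card β - I.card))) fun J hJ => ?_).trans
        (le_of_eq ?_))
      · have := card_determined_le I J (D I J) fun X hX => (Finset.mem_filter.1 hX).2
        rwa [(Finset.mem_powersetCard.1 hJ).2] at this
      · rw [Finset.sum_const, Finset.card_powersetCard, Finset.card_univ, nsmul_eq_mul]
        ring
    · simp [E, g, hI]
  have hsub : 𝒳 ⊆ (Finset.univ : Finset α).powerset.biUnion E := by
    intro X hX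
    obtain ⟨I, a, hI, ha, hsum, huniq⟩ := h𝒳 X hX
    obtain ⟨J, hJ, hJu⟩ := exists_card_eq_determining I (fun j i => ((X j i : ℤ) : ℝ)) huniq
    refine Finset.mem_biUnion.2 ⟨I, by simp, ?_⟩
    simp only [E, hI, if_true]
    refine Finset.mem_biUnion.2 ⟨J, by simp [Finset.mem_powersetCard, hJ], ?_⟩
    exact Finset.mem_filter.2 ⟨hX, a, ha, hsum, hJu⟩
  have h1 : (𝒳.card : ℝ) ≤ ∑ I ∈ (Finset.univ : Finset α).powerset, ((E I).card : ℝ) := by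
    exact_mod_cast (Finset.card_le_card hsub).trans Finset.card_biUnion_le
  refine h1.trans ((Finset.sum_le_sum fun I _ => hE I).trans (le_of_eq ?_))
  rw [← Finset.mul_sum, Finset.sum_powerset_apply_card, Finset.card_univ]
  congr 1
  refine Finset.sum_congr rfl fun r _ => ?_
  simp only [g, nsmul_eq_mul]
  split_ifs <;> ring

/-- Union bound over ordered pairs of columns and the sign e; each row satisfies the relation with
probability 1/2. -/
theorem card_proportional_columns_le {α β : Type*} [Fintype α] [DecidableEq α] [Fintype β]
    [DecidableEq β] (𝒳 : Finset (β → α → ℤˣ))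
    (h𝒳 : ∀ X ∈ 𝒳, ∃ i k, i ≠ k ∧ ∃ e : ℤˣ, ∀ j, X j i = e * X j k) :
    (𝒳.card : ℝ) ≤ 2 ^ (Fintype.card α * Fintype.card β) *
      (2 * Fintype.card α ^ 2 / 2 ^ Fintype.card β) := by
  classical
  let F : (α × α) × ℤˣ → Finset (β → α → ℤˣ) := fun q => if q.1.1 = q.1.2 then ∅ else
    Fintype.piFinset fun _ => Finset.univ.filter fun ρ : α → ℤˣ => ρ q.1.1 = q.2 * ρ q.1.2
  have hF : ∀ q, (F q).card * 2 ^ Fintype.card β ≤ 2 ^ (Fintype.card α * Fintype.card β) := by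
    rintro ⟨⟨i, k⟩, e⟩
    by_cases hik : i = k
    · simp [F, hik]
    · have h1 := card_partialSignedSum_eq_le {i, k} (fun l => if l = i then 1 else
        - ((e : ℤ) : ℝ)) (fun l _ => by split_ifs <;> simp) 0
      rw [Finset.card_pair hik] at h1
      simp only [Finset.sum_pair hik, if_true, Ne.symm hik, if_false] at h1
      have h2 : (Finset.univ.filter fun ρ : α → ℤˣ => ρ i = e * ρ k).card * 2 ≤
          2 ^ Fintype.card α := by
        have h3 : (Finset.univ.filter fun ρ : α → ℤˣ => ρ i = e * ρ k) ⊆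
            Finset.univ.filter fun ρ : α → ℤˣ =>
              1 * ((ρ i : ℤ) : ℝ) + - ((e : ℤ) : ℝ) * ((ρ k : ℤ) : ℝ) = 0 := by
          intro ρ hρ
          simp only [Finset.mem_filter, Finset.mem_univ, true_and] at hρ ⊢
          rw [hρ]
          push_cast
          ring
        have h4 := Finset.card_le_card h3
        norm_num at h1 h4 ⊢
        omega
      simp only [F, hik, if_false, Fintype.card_piFinset, Finset.prod_const, Finset.card_univ]
      rw [← mul_pow, pow_mul]
      exact Nat.pow_le_pow_left h2 _
  have hsub : 𝒳 ⊆ Finset.univ.biUnion F := by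
    intro X hX
    obtain ⟨i, k, hik, e, h⟩ := h𝒳 X hX
    refine Finset.mem_biUnion.2 ⟨((i, k), e), Finset.mem_univ _, ?_⟩
    simp only [F, hik, if_false, Fintype.mem_piFinset, Finset.mem_filter, Finset.mem_univ,
      true_and]
    exact h
  have h1 : 𝒳.card * 2 ^ Fintype.card β ≤
      2 ^ (Fintype.card α * Fintype.card β) * (2 * Fintype.card α ^ 2) := by
    refine (Nat.mul_le_mul_right _ ((Finset.card_le_card hsub).trans
      Finset.card_biUnion_le)).trans ?_
    rw [Finset.sum_mul]
    refine (Finset.sum_le_sum fun q _ => hF q).trans (le_of_eq ?_)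
    simp only [Finset.sum_const, Finset.card_univ, Fintype.card_prod, Fintype.card_units_int,
      smul_eq_mul]
    ring
  rw [← mul_div_assoc, le_div_iff₀ (by positivity)]
  exact_mod_cast h1

/-- A matrix of signs is generic if its columns are pairwise not proportional and it is not
exceptional. -/
def IsGenericSignMatrix {α β : Type*} (X : β → α → ℤˣ) : Prop :=
  (∀ i k, i ≠ k → ¬ ∃ e : ℤˣ, ∀ j, X j i = e * X j k) ∧ ¬ IsExceptional X

/-- A vector of signs which is a combination of columns of a generic matrix of signs is
proportional to one of these columns. -/
theorem IsGenericSignMatrix.exists_eq_mul {α β : Type*} [DecidableEq α] [Nonempty β]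
    {X : β → α → ℤˣ} (hX : IsGenericSignMatrix X) (I₀ : Finset α) (a₀ : α → ℝ) (w : β → ℤˣ)
    (hw : ∀ j, ∑ i ∈ I₀, a₀ i * ((X j i : ℤ) : ℝ) = ((w j : ℤ) : ℝ)) :
    ∃ i ∈ I₀, ∃ e : ℤˣ, ∀ j, w j = e * X j i := by
  classical
  -- In a representation of w by the fewest columns, the coefficients are nonzero and the columns
  -- independent; as the matrix is not exceptional, at most two columns occur.
  let 𝒥 : Finset (Finset α) := I₀.powerset.filter fun I => ∃ a : α → ℝ, ∀ j,
    ∑ i ∈ I, a i * ((X j i : ℤ) : ℝ) = ((w j : ℤ) : ℝ)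
  obtain ⟨I, hI, hmin⟩ := 𝒥.exists_min_image Finset.card
    ⟨I₀, Finset.mem_filter.2 ⟨Finset.mem_powerset_self _, a₀, hw⟩⟩
  obtain ⟨hII₀, a, ha⟩ := Finset.mem_filter.1 hI
  rw [Finset.mem_powerset] at hII₀
  have herase : ∀ (b : α → ℝ), (∀ j, ∑ i ∈ I, b i * ((X j i : ℤ) : ℝ) = ((w j : ℤ) : ℝ)) →
      ∀ i ∈ I, b i ≠ 0 := by
    intro b hb i hi h0
    have := hmin (I.erase i) (Finset.mem_filter.2 ⟨Finset.mem_powerset.2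
      ((Finset.erase_subset _ _).trans hII₀), b, fun j => by
        rw [← hb j, ← Finset.add_sum_erase _ _ hi, h0, zero_mul, zero_add]⟩)
    exact absurd this (not_le.2 (Finset.card_erase_lt_of_mem hi))
  have huniq : ∀ b : α → ℝ, (∀ j, ∑ i ∈ I, b i * ((X j i : ℤ) : ℝ) = 0) → ∀ i ∈ I, b i = 0 := by
    intro b hb i hi
    by_contra hbi
    refine herase (fun k => a k - a i / b i * b k) (fun j => ?_) i hi (by field_simp; ring)
    simp only [sub_mul, Finset.sum_sub_distrib, ha, mul_assoc, ← Finset.mul_sum, hb]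
    ring
  have h3 : I.card < 3 := by
    by_contra h3
    exact hX.2 ⟨I, a, not_lt.1 h3, herase a ha, fun j => ⟨w j, ha j⟩, huniq⟩
  obtain ⟨j₀⟩ := ‹Nonempty β›
  have hsq : ∀ e : ℤˣ, ((e : ℤ) : ℝ) * ((e : ℤ) : ℝ) = 1 := by
    intro e
    rcases Int.units_eq_one_or e with h | h <;> simp [h]
  have h012 : I.card = 0 ∨ I.card = 1 ∨ I.card = 2 := by omega
  rcases h012 with h | h | h
  · rw [Finset.card_eq_zero.1 h] at ha
    have := ha j₀
    simp only [Finset.sum_empty] at this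
    exact absurd this.symm (intUnit_cast_ne_zero _)
  · obtain ⟨i, rfl⟩ := Finset.card_eq_one.1 h
    simp only [Finset.sum_singleton] at ha
    refine ⟨i, hII₀ (Finset.mem_singleton_self i), w j₀ * X j₀ i, fun j => ?_⟩
    have h1 : ((w j : ℤ) : ℝ) = ((w j₀ : ℤ) : ℝ) * ((X j₀ i : ℤ) : ℝ) * ((X j i : ℤ) : ℝ) := by
      rw [← ha j, ← ha j₀, mul_assoc (a i), hsq, mul_one]
    exact_mod_cast h1
  · obtain ⟨i, k, hik, rfl⟩ := Finset.card_eq_two.1 h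
    have hne := herase a ha
    simp only [Finset.sum_pair hik] at ha
    -- Two nonproportional columns agree in some row and are opposite in another, so a_i + a_k and
    -- a_i - a_k are both ±1; hence a_i a_k = 0.
    have hcol : ∀ e : ℤˣ, ∃ j, X j i = e * X j k := by
      intro e
      by_contra! hcon
      refine hX.1 i k hik ⟨-e, fun j => ?_⟩
      rw [neg_mul, ← intUnit_eq_neg_of_ne (hcon j).symm]
    obtain ⟨j, hj⟩ := hcol 1
    obtain ⟨j', hj'⟩ := hcol (-1)
    have e1 := hsq (w j)
    have e2 := hsq (w j')
    rw [← ha, hj] at e1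
    rw [← ha, hj'] at e2
    push_cast at e1 e2
    have e3 := hsq (X j k)
    have e4 := hsq (X j' k)
    have e5 : (a i + a k) ^ 2 = 1 := by
      linear_combination e1 - (a i + a k) ^ 2 * e3
    have e6 : (a i - a k) ^ 2 = 1 := by
      linear_combination e2 - (a i - a k) ^ 2 * e4
    have e7 : a i * a k = 0 := by linear_combination (e5 - e6) / 4
    rcases mul_eq_zero.1 e7 with h | h
    · exact absurd h (hne i (by simp))
    · exact absurd h (hne k (by simp))

theorem IsGenericSignMatrix.injective {α β : Type*} {X : β → α → ℤˣ}
    (hX : IsGenericSignMatrix X) : Function.Injective fun i j => X j i := by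
  intro i k h
  by_contra hik
  exact hX.1 i k hik ⟨1, fun j => by rw [one_mul]; exact congrFun h j⟩

/-- In a relation expressing the form of w, coordinate 0 says that the coefficients sum to 1 and the
others that w is a combination of columns. So w is e times a column; independence leaves the single
coefficient e, which must be 1, and w would be one of the columns used. -/
theorem IsGenericSignMatrix.notMem_span {α : Type*} [Fintype α] [DecidableEq α] {n : ℕ}
    (hn : n ≠ 0) {X : Fin n → α → ℤˣ} (hX : IsGenericSignMatrix X) (w : Fin n → ℤˣ) :
    thresholdForm w ∉ Submodule.span ℝ (thresholdForm ''
      (((Finset.univ.image fun i j => X j i : Finset (Fin n → ℤˣ)) : Set (Fin n → ℤˣ)) \ {w})) := by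
  classical
  have : Nonempty (Fin n) := Fin.pos_iff_nonempty.1 (Nat.pos_of_ne_zero hn)
  intro h
  let I₀ : Finset α := Finset.univ.filter fun i => (fun j => X j i) ≠ w
  have hset : thresholdForm '' (((Finset.univ.image fun i j => X j i : Finset (Fin n → ℤˣ)) :
      Set (Fin n → ℤˣ)) \ {w}) = (fun i => thresholdForm fun j => X j i) '' (I₀ : Set α) := by
    ext f
    simp only [Set.mem_image, Set.mem_sdiff, Finset.coe_image, Finset.coe_univ, Set.image_univ,
      Set.mem_range, Set.mem_singleton_iff, Finset.mem_coe, I₀, Finset.mem_filter,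
      Finset.mem_univ, true_and]
    constructor
    · rintro ⟨_, ⟨⟨i, rfl⟩, hi⟩, rfl⟩
      exact ⟨i, hi, rfl⟩
    · rintro ⟨i, hi, rfl⟩
      exact ⟨_, ⟨⟨i, rfl⟩, hi⟩, rfl⟩
  rw [hset, Submodule.mem_span_image_finset_iff_exists_fun] at h
  obtain ⟨c', hc'⟩ := h
  obtain ⟨c, hc⟩ : ∃ c : α → ℝ,
      ∑ i ∈ I₀, c i • thresholdForm (fun j => X j i) = thresholdForm w := by
    refine ⟨fun i => if h : i ∈ I₀ then c' ⟨i, h⟩ else 0, ?_⟩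
    rw [← hc', ← Finset.sum_attach]
    exact Finset.sum_congr rfl fun i _ => by simp
  have hsum : ∑ i ∈ I₀, c i = 1 := by
    have := LinearMap.congr_fun hc (Pi.single 0 1)
    simpa [LinearMap.sum_apply, thresholdForm_single_zero] using this
  have hcol : ∀ j, ∑ i ∈ I₀, c i * ((X j i : ℤ) : ℝ) = ((w j : ℤ) : ℝ) := by
    intro j
    have := LinearMap.congr_fun hc (Pi.single j.succ 1)
    simpa [LinearMap.sum_apply, thresholdForm_single_succ] using this
  obtain ⟨i₀, hi₀, e, he⟩ := hX.exists_eq_mul I₀ c w hcol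
  have hcol0 : ∀ j, ∑ i ∈ I₀, (c i - if i = i₀ then ((e : ℤ) : ℝ) else 0) *
      ((X j i : ℤ) : ℝ) = 0 := by
    intro j
    simp only [sub_mul, Finset.sum_sub_distrib, hcol, ite_mul, zero_mul]
    rw [Finset.sum_ite_eq' I₀ i₀, if_pos hi₀, he]
    push_cast
    ring
  -- A nontrivial relation would write one column through the others, making it proportional to one
  -- of them.
  have hzero : ∀ k ∈ I₀, c k - (if k = i₀ then ((e : ℤ) : ℝ) else 0) = 0 := by
    intro k hk
    by_contra hne
    set d : α → ℝ := fun i => c i - if i = i₀ then ((e : ℤ) : ℝ) else 0 with hd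
    obtain ⟨i, hi, e', he'⟩ := hX.exists_eq_mul (I₀.erase k) (fun i => - (d i / d k))
      (fun j => X j k) (fun j => by
        have h1 := hcol0 j
        rw [← Finset.add_sum_erase _ _ hk] at h1
        have h2 : ∑ i ∈ I₀.erase k, - (d i / d k) * ((X j i : ℤ) : ℝ) =
            - (∑ i ∈ I₀.erase k, d i * ((X j i : ℤ) : ℝ)) / d k := by
          rw [neg_div, Finset.sum_div, ← Finset.sum_neg_distrib]
          exact Finset.sum_congr rfl fun i _ => by ring
        rw [h2, div_eq_iff hne]
        linarith)
    exact hX.1 k i (Finset.ne_of_mem_erase hi).symm ⟨e', he'⟩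
  have hc1 : ∑ i ∈ I₀, c i = ((e : ℤ) : ℝ) := by
    rw [Finset.sum_congr rfl fun i hi => sub_eq_zero.1 (hzero i hi), Finset.sum_ite_eq' I₀ i₀,
      if_pos hi₀]
  have he1 : e = 1 := by
    rw [hsum] at hc1
    rcases Int.units_eq_one_or e with h | h
    · exact h
    · norm_num [h] at hc1
  refine (Finset.mem_filter.1 hi₀).2 (funext fun j => ?_)
  rw [he j, he1, one_mul]

/-- The columns of generic matrices of signs provide strongly shattered sets. -/
theorem card_generic_le {n p : ℕ} (hn : n ≠ 0) (𝒳 : Finset (Fin n → Fin p → ℤˣ))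
    (h𝒳 : ∀ X ∈ 𝒳, IsGenericSignMatrix X) : 𝒳.card ≤ p ^ p * numThreshold n := by
  classical
  let f : (Fin n → Fin p → ℤˣ) → Finset (Fin n → ℤˣ) := fun X =>
    Finset.univ.image fun i j => X j i
  refine (Finset.card_le_mul_card_image (f := f) 𝒳 (p ^ p) ?_).trans
    (Nat.mul_le_mul_left _ (card_le_numThreshold_of_forall_notMem_span _ ?_))
  · intro T hT
    have hTc : T.card = p := by
      obtain ⟨X, hX, rfl⟩ := Finset.mem_image.1 hT
      rw [Finset.card_image_of_injective _ (h𝒳 X hX).injective, Finset.card_univ, Fintype.card_fin]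
    have h1 : (Fintype.piFinset fun _ : Fin p => T).card = p ^ p := by
      simp [hTc]
    rw [← h1]
    refine Finset.card_le_card_of_injOn (fun X i j => X j i) ?_ ?_
    · intro X hX
      refine Finset.mem_coe.2 (Fintype.mem_piFinset.2 fun i => ?_)
      rw [← (Finset.mem_filter.1 hX).2]
      exact Finset.mem_image_of_mem _ (Finset.mem_univ i)
    · intro X _ Y _ h
      funext j i
      exact congrFun (congrFun h i) j
  · intro S hS x
    obtain ⟨X, hX, rfl⟩ := Finset.mem_image.1 hS
    exact (h𝒳 X hX).notMem_span hn x

/-- The hypothesis bounds the probability of not being generic by 1/2, so at least half of all sign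
matrices are generic. -/
theorem le_numThreshold_of_sum_le {n p : ℕ} (hn : n ≠ 0)
    (h : 2 * (p : ℝ) ^ 2 / 2 ^ n + ∑ r ∈ Finset.range (p + 1), (if 3 ≤ r then
        (p.choose r : ℝ) * n.choose r * (2 ^ r * offordBound r ^ (n - r)) else 0) ≤ 1 / 2) :
    (2 : ℝ) ^ (p * n) ≤ 2 * p ^ p * numThreshold n := by
  classical
  let 𝒳 : Finset (Fin n → Fin p → ℤˣ) := Finset.univ.filter IsGenericSignMatrix
  let 𝒬 : Finset (Fin n → Fin p → ℤˣ) :=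
    Finset.univ.filter fun X => ∃ i k, i ≠ k ∧ ∃ e : ℤˣ, ∀ j, X j i = e * X j k
  let ℰ : Finset (Fin n → Fin p → ℤˣ) := Finset.univ.filter IsExceptional
  have h1 := card_generic_le hn 𝒳 fun X hX => (Finset.mem_filter.1 hX).2
  have h2 := card_proportional_columns_le 𝒬 fun X hX => (Finset.mem_filter.1 hX).2
  have h3 := card_isExceptional_le ℰ fun X hX => (Finset.mem_filter.1 hX).2
  have h4 : (Finset.univ : Finset (Fin n → Fin p → ℤˣ)) ⊆ 𝒳 ∪ (𝒬 ∪ ℰ) := by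
    intro X _
    simp only [𝒳, 𝒬, ℰ, Finset.mem_union, Finset.mem_filter, Finset.mem_univ, true_and,
      IsGenericSignMatrix]
    by_cases hE : IsExceptional X
    · exact Or.inr (Or.inr hE)
    · by_cases hP : ∃ i k, i ≠ k ∧ ∃ e : ℤˣ, ∀ j, X j i = e * X j k
      · exact Or.inr (Or.inl hP)
      · exact Or.inl ⟨fun i k hik he => hP ⟨i, k, hik, he⟩, hE⟩
  have h5 : ((Finset.univ : Finset (Fin n → Fin p → ℤˣ)).card : ℝ) ≤
      𝒳.card + (𝒬.card + ℰ.card) := by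
    exact_mod_cast (Finset.card_le_card h4).trans ((Finset.card_union_le _ _).trans
      (Nat.add_le_add_left (Finset.card_union_le _ _) _))
  have h6 : ((Finset.univ : Finset (Fin n → Fin p → ℤˣ)).card : ℝ) = 2 ^ (p * n) := by
    simp [Finset.card_univ, pow_mul]
  have h1' : (𝒳.card : ℝ) ≤ p ^ p * numThreshold n := by exact_mod_cast h1
  simp only [Fintype.card_fin] at h2 h3
  have h7 := mul_le_mul_of_nonneg_left h (by positivity : (0 : ℝ) ≤ 2 ^ (p * n))
  rw [mul_add] at h7
  rw [h6] at h5
  linarith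

/-! ### Numerical estimates -/

theorem offordBound_succ_le (r : ℕ) : offordBound (r + 1) ≤ offordBound r := by
  have h : (r + 1).choose ((r + 1) / 2) ≤ 2 * r.choose (r / 2) := by
    rcases Nat.eq_zero_or_pos ((r + 1) / 2) with h0 | h0
    · rw [h0, Nat.choose_zero_right]
      have := Nat.choose_pos (Nat.div_le_self r 2)
      omega
    · obtain ⟨k, hk⟩ := Nat.exists_eq_succ_of_ne_zero h0.ne'
      rw [hk, Nat.succ_eq_add_one, Nat.choose_succ_succ, two_mul]
      exact Nat.add_le_add (Nat.choose_le_middle _ _) (Nat.choose_le_middle _ _)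
  have h' : ((r + 1).choose ((r + 1) / 2) : ℝ) ≤ 2 * r.choose (r / 2) := by exact_mod_cast h
  rw [offordBound, offordBound, div_le_div_iff₀ (by positivity) (by positivity), pow_succ]
  nlinarith [pow_pos (two_pos (α := ℝ)) r]

theorem offordBound_antitone : Antitone offordBound := antitone_nat_of_succ_le offordBound_succ_le

theorem offordBound_le_three_quarters {r : ℕ} (hr : 3 ≤ r) : offordBound r ≤ 3 / 4 := by
  refine (offordBound_antitone hr).trans (le_of_eq ?_)
  norm_num [offordBound, Nat.choose]

/-- The factor 3m + 1 makes the induction close: (2m+1)²(3m+4) and 4(m+1)²(3m+1) differ only by m.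
-/
theorem centralBinom_sq_mul_le (m : ℕ) : m.centralBinom ^ 2 * (3 * m + 1) ≤ 16 ^ m := by
  induction m with
  | zero => simp
  | succ m ih =>
    have h := Nat.succ_mul_centralBinom_succ m
    have hpos : 0 < (m + 1) ^ 2 := by positivity
    refine Nat.le_of_mul_le_mul_left ?_ hpos
    calc (m + 1) ^ 2 * ((m + 1).centralBinom ^ 2 * (3 * (m + 1) + 1))
        = ((m + 1) * (m + 1).centralBinom) ^ 2 * (3 * (m + 1) + 1) := by ring
      _ = m.centralBinom ^ 2 * (4 * (2 * m + 1) ^ 2 * (3 * m + 4)) := by rw [h]; ring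
      _ ≤ m.centralBinom ^ 2 * (16 * (m + 1) ^ 2 * (3 * m + 1)) := by
          refine Nat.mul_le_mul_left _ ?_
          nlinarith
      _ = (m + 1) ^ 2 * (16 * (m.centralBinom ^ 2 * (3 * m + 1))) := by ring
      _ ≤ (m + 1) ^ 2 * (16 * 16 ^ m) := by gcongr
      _ = (m + 1) ^ 2 * 16 ^ (m + 1) := by ring

/-- For r = 2m + 1 monotonicity reduces to 2m, and 3r - 1 = 2(3m + 1); even r has room to spare. -/
theorem offordBound_sq_mul_le {r : ℕ} (hr : 1 ≤ r) : offordBound r ^ 2 * (3 * r - 1) ≤ 8 := by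
  have heven : ∀ m : ℕ, offordBound (2 * m) ^ 2 * (3 * m + 1) ≤ 4 := by
    intro m
    have h : (m.centralBinom : ℝ) ^ 2 * (3 * m + 1) ≤ 16 ^ m := by
      exact_mod_cast centralBinom_sq_mul_le m
    rw [offordBound, Nat.mul_div_cancel_left m two_pos, ← Nat.centralBinom_eq_two_mul_choose,
      div_pow, div_mul_eq_mul_div, div_le_iff₀ (by positivity), ← pow_mul, mul_comm (2 * m) 2,
      ← mul_assoc, pow_mul]
    norm_num
    linarith
  rcases Nat.even_or_odd' r with ⟨m, rfl | rfl⟩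
  · have := heven m
    push_cast
    nlinarith [sq_nonneg (offordBound (2 * m))]
  · have h1 := heven m
    have h2 : offordBound (2 * m + 1) ^ 2 ≤ offordBound (2 * m) ^ 2 :=
      pow_le_pow_left₀ (offordBound_nonneg _) (offordBound_succ_le _) 2
    have h3 := mul_le_mul_of_nonneg_right h2 (by positivity : (0 : ℝ) ≤ 3 * m + 1)
    push_cast
    linarith

theorem offordBound_pow_le_exp {r : ℕ} {c : ℝ} (h : offordBound r ^ 2 ≤ Real.exp (-(2 * c)))
    (k : ℕ) : offordBound r ^ k ≤ Real.exp (-(c * k)) := by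
  have h1 : offordBound r ≤ Real.exp (-c) := by
    rw [← pow_le_pow_iff_left₀ (offordBound_nonneg r) (Real.exp_pos _).le two_ne_zero,
      ← Real.exp_nat_mul]
    rwa [Nat.cast_ofNat, mul_neg]
  calc offordBound r ^ k ≤ Real.exp (-c) ^ k := pow_le_pow_left₀ (offordBound_nonneg r) h1 k
    _ = Real.exp (-(c * k)) := by rw [← Real.exp_nat_mul]; congr 1; ring

/-- The tangent line of the logarithm at e^10, with 22026 ≤ e^10. -/
theorem log_le_nine_add {x : ℝ} (hx : 0 < x) : Real.log x ≤ 9 + x / 22026 := by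
  have h10 : (22026 : ℝ) ≤ Real.exp 10 := by
    have h1 : Real.exp 10 = Real.exp 1 ^ 10 := by rw [← Real.exp_nat_mul]; norm_num
    rw [h1]
    calc (22026 : ℝ) ≤ 2.7182818283 ^ 10 := by norm_num
      _ ≤ Real.exp 1 ^ 10 := pow_le_pow_left₀ (by norm_num) Real.exp_one_gt_d9.le 10
  have h2 := Real.log_le_sub_one_of_pos (div_pos hx (Real.exp_pos 10))
  rw [Real.log_div hx.ne' (Real.exp_pos 10).ne', Real.log_exp] at h2
  have h3 : x / Real.exp 10 ≤ x / 22026 := by gcongr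
  linarith

theorem le_of_ten_le_log {n : ℕ} (hL : 10 ≤ Real.log n) : (22026 : ℝ) ≤ n := by
  have hn : (0 : ℝ) < n := by
    rcases Nat.eq_zero_or_pos n with rfl | h
    · norm_num at hL
    · exact_mod_cast h
  have := log_le_nine_add hn
  rw [← one_le_div (by norm_num : (0 : ℝ) < 22026)]
  linarith

theorem choose_mul_choose_mul_two_pow_le {n p r : ℕ} (hpn : p ≤ n) (hrp : r ≤ p) :
    (p.choose r : ℝ) * n.choose r * 2 ^ r ≤ Real.exp (3 * Real.log 2 * n) := by
  have h1 : p.choose r ≤ 2 ^ n :=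
    (Nat.choose_le_two_pow p r).trans (Nat.pow_le_pow_right two_pos hpn)
  have h2 : n.choose r ≤ 2 ^ n := Nat.choose_le_two_pow n r
  have h3 : 2 ^ r ≤ 2 ^ n := Nat.pow_le_pow_right two_pos (hrp.trans hpn)
  have h4 : p.choose r * n.choose r * 2 ^ r ≤ 2 ^ n * 2 ^ n * 2 ^ n := by gcongr
  have h5 : Real.exp (3 * Real.log 2 * n) = 2 ^ n * 2 ^ n * 2 ^ n := by
    have : 3 * Real.log 2 * n = n * Real.log 2 + n * Real.log 2 + n * Real.log 2 := by ring
    rw [this, Real.exp_add, Real.exp_add, Real.exp_nat_mul, Real.exp_log two_pos]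
  rw [h5]
  exact_mod_cast h4

theorem log_four_mul {x : ℝ} (hx : 0 < x) : Real.log (4 * x) = 2 * Real.log 2 + Real.log x := by
  rw [Real.log_mul (by norm_num) hx.ne', show (4 : ℝ) = 2 ^ 2 by norm_num, Real.log_pow]
  norm_num

/-- Three ranges of r. For r ≤ 256 the binomials are polynomial in n against (3/4)^(n-r). For 256 <
r ≤ n/16 the prefactor 8^n loses to `offordBound` ≤ 96^(-1/2). For r > n/16 the bound is at most
8/√n, and n - r ≥ 8n/ln n, the reason for the choice of p, makes its power beat 8^n. -/
theorem exceptional_term_le {n p r : ℕ} (hL : 10 ≤ Real.log n)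
    (hp : (p : ℝ) ≤ n - 8 * n / Real.log n) (hr : 3 ≤ r) (hrp : r ≤ p) :
    (p.choose r : ℝ) * n.choose r * (2 ^ r * offordBound r ^ (n - r)) ≤ 1 / (4 * n) := by
  have hn := le_of_ten_le_log hL
  have hn0 : (0 : ℝ) < n := by linarith
  have hlog := log_le_nine_add hn0
  have hl2 := Real.log_two_gt_d9
  have hl2' := Real.log_two_lt_d9
  set L := Real.log n with hLdef
  have hdiv : 0 ≤ 8 * n / L := by positivity
  have hpn : p ≤ n := by
    have : (p : ℝ) ≤ n := by linarith
    exact_mod_cast this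
  have hrn : r ≤ n := hrp.trans hpn
  have hk : ((n - r : ℕ) : ℝ) = n - r := Nat.cast_sub hrn
  have hrR : (3 : ℝ) ≤ r := by exact_mod_cast hr
  have hgoal : (1 : ℝ) / (4 * n) = Real.exp (-(2 * Real.log 2 + L)) := by
    rw [Real.exp_neg, ← log_four_mul hn0, Real.exp_log (by positivity), one_div]
  rw [hgoal, ← mul_assoc]
  have key : ∀ A c : ℝ, (p.choose r : ℝ) * n.choose r * 2 ^ r ≤ Real.exp A →
      offordBound r ^ 2 ≤ Real.exp (-(2 * c)) → A - c * (n - r) ≤ -(2 * Real.log 2 + L) →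
      (p.choose r : ℝ) * n.choose r * 2 ^ r * offordBound r ^ (n - r) ≤
        Real.exp (-(2 * Real.log 2 + L)) := by
    intro A c hA hc hAc
    calc (p.choose r : ℝ) * n.choose r * 2 ^ r * offordBound r ^ (n - r)
        ≤ Real.exp A * Real.exp (-(c * (n - r : ℕ))) :=
          mul_le_mul hA (offordBound_pow_le_exp hc _) (pow_nonneg (offordBound_nonneg r) _)
            (Real.exp_pos _).le
      _ ≤ _ := by
          rw [← Real.exp_add, hk]
          exact Real.exp_le_exp.2 (by linarith)
  rcases le_or_gt r 256 with h256 | h256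
  · have hr' : (r : ℝ) ≤ 256 := by exact_mod_cast h256
    refine key (r * (Real.log 2 + 2 * L)) (1 / 4) ?_ ?_ ?_
    · have h1 : (p.choose r : ℝ) ≤ n ^ r := by
        exact_mod_cast (Nat.choose_le_pow p r).trans (Nat.pow_le_pow_left hpn r)
      have h2 : (n.choose r : ℝ) ≤ n ^ r := by exact_mod_cast Nat.choose_le_pow n r
      have h3 : Real.exp (r * (Real.log 2 + 2 * L)) = n ^ r * n ^ r * 2 ^ r := by
        rw [Real.exp_nat_mul, Real.exp_add, two_mul, Real.exp_add, Real.exp_log two_pos,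
          hLdef, Real.exp_log hn0]
        ring
      rw [h3]
      gcongr
    · have h1 := Real.add_one_le_exp (-(1 / 4 : ℝ))
      have h2 := offordBound_le_three_quarters hr
      have h3 : Real.exp (-(2 * (1 / 4 : ℝ))) = Real.exp (-(1 / 4 : ℝ)) ^ 2 := by
        rw [← Real.exp_nat_mul]
        norm_num
      rw [h3]
      exact pow_le_pow_left₀ (offordBound_nonneg r) (by linarith) 2
    · have h1 : r * (Real.log 2 + 2 * L) ≤ 256 * (1 + 2 * L) := by
        apply mul_le_mul hr' <;> linarith
      linarith
  · have hr' : (257 : ℝ) ≤ r := by exact_mod_cast h256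
    have hsq := offordBound_sq_mul_le (r := r) (by omega)
    have hq0 := sq_nonneg (offordBound r)
    rcases le_or_gt (16 * r) n with h16 | h16
    · have h16' : 16 * (r : ℝ) ≤ n := by exact_mod_cast h16
      -- This makes 96^(-1/2) at most 2^(-36/11), and (36/11)(15/16) exceeds 3.
      have h96 : 72 * Real.log 2 ≤ 11 * Real.log 96 := by
        have := Real.log_le_log (by norm_num) (by norm_num : (2 : ℝ) ^ 72 ≤ 96 ^ 11)
        rw [Real.log_pow, Real.log_pow] at this
        exact_mod_cast this
      refine key (3 * Real.log 2 * n) (36 / 11 * Real.log 2)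
        (choose_mul_choose_mul_two_pow_le hpn hrp) ?_ ?_
      · have h1 : offordBound r ^ 2 ≤ 1 / 96 := by nlinarith
        refine h1.trans ?_
        rw [one_div, ← Real.exp_log (by norm_num : (0 : ℝ) < 96), ← Real.exp_neg]
        exact Real.exp_le_exp.2 (by linarith)
      · have h1 : 36 / 11 * Real.log 2 * (15 / 16 * n) ≤ 36 / 11 * Real.log 2 * (n - r) := by
          gcongr
          linarith
        nlinarith
    · have h16' : (n : ℝ) < 16 * r := by exact_mod_cast h16
      refine key (3 * Real.log 2 * n) ((L - 6 * Real.log 2) / 2)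
        (choose_mul_choose_mul_two_pow_le hpn hrp) ?_ ?_
      · have h1 : offordBound r ^ 2 * n ≤ 64 := by nlinarith
        have h2 : -(2 * ((L - 6 * Real.log 2) / 2)) = (6 : ℕ) * Real.log 2 - L := by
          push_cast
          ring
        rw [h2, Real.exp_sub, Real.exp_nat_mul, Real.exp_log two_pos, hLdef, Real.exp_log hn0,
          le_div_iff₀ hn0]
        norm_num
        exact h1
      · have h1 : 8 * n / L ≤ n - r := by
          have : (r : ℝ) ≤ p := by exact_mod_cast hrp
          linarith
        have h2 : 0 ≤ (L - 6 * Real.log 2) / 2 := by linarith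
        have h3 := mul_le_mul_of_nonneg_left h1 h2
        have h4 : (L - 6 * Real.log 2) / 2 * (8 * n / L) =
            4 * n - 24 * Real.log 2 * (n / L) := by
          field_simp
          ring
        have h5 : n / L ≤ n / 10 := by gcongr
        have h6 : 24 * Real.log 2 * (n / L) ≤ 24 * Real.log 2 * (n / 10) := by gcongr
        nlinarith

/-- With p = ⌊n - 8n/L⌋, L = ln n, the two failure probabilities are at most 1/4 each. In
log₂(2^(pn) / (2 p^p)) the definition of p costs 8n²/L; the rounding, the factor 2 and p^p are
absorbed in another 2n²/L. -/
theorem le_logb_numThreshold {n : ℕ} (hL : 10 ≤ Real.log n) :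
    (n : ℝ) ^ 2 - 10 * (n : ℝ) ^ 2 / Real.log n ≤ Real.logb 2 (numThreshold n) := by
  have hn := le_of_ten_le_log hL
  have hn0 : (0 : ℝ) < n := by linarith
  have hlog := log_le_nine_add hn0
  have hl2 := Real.log_two_gt_d9
  have hl2' := Real.log_two_lt_d9
  -- From the cubic Taylor term of exp; it makes L small against n/L when the lower-order losses are
  -- absorbed.
  have hL3 : Real.log n ^ 3 ≤ 6 * n := by
    have h1 := Real.pow_div_factorial_le_exp (Real.log n) (by linarith) 3
    rw [Real.exp_log hn0] at h1
    norm_num [Nat.factorial] at h1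
    linarith
  set L := Real.log n with hLdef
  have hdL : n / L ≤ n / 10 := by gcongr
  have hdiv : 8 * n / L = 8 * (n / L) := by ring
  set p := ⌊(n : ℝ) - 8 * n / L⌋₊ with hpdef
  have hp : (p : ℝ) ≤ n - 8 * n / L := Nat.floor_le (by rw [hdiv]; linarith)
  have hp' : (n : ℝ) - 8 * n / L < p + 1 := Nat.lt_floor_add_one _
  have hp1 : (1 : ℝ) ≤ p := by
    have : (0 : ℝ) < p := by rw [hdiv] at hp'; linarith
    exact_mod_cast this
  have hLn : 1 ≤ n / L := by
    rw [one_le_div (by linarith)]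
    linarith
  have hpn : (p : ℝ) + 1 ≤ n := by rw [hdiv] at hp; linarith
  have hsum : ∑ r ∈ Finset.range (p + 1), (if 3 ≤ r then
      (p.choose r : ℝ) * n.choose r * (2 ^ r * offordBound r ^ (n - r)) else 0) ≤ 1 / 4 := by
    calc _ ≤ ∑ _r ∈ Finset.range (p + 1), (1 : ℝ) / (4 * n) := by
          refine Finset.sum_le_sum fun r hr => ?_
          split_ifs with h3
          · exact exceptional_term_le hL hp h3 (Nat.lt_succ_iff.1 (Finset.mem_range.1 hr))
          · positivity
      _ = (p + 1) * (1 / (4 * n)) := by simp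
      _ ≤ n * (1 / (4 * n)) := by gcongr
      _ = 1 / 4 := by field_simp
  have hpow : 2 * (p : ℝ) ^ 2 / 2 ^ n ≤ 1 / 4 := by
    rw [div_le_iff₀ (by positivity)]
    have h1 : (8 : ℝ) * n ^ 2 ≤ 2 ^ n := by
      rw [← Real.log_le_log_iff (by positivity) (by positivity), Real.log_mul (by norm_num)
        (by positivity), Real.log_pow, Real.log_pow, show (8 : ℝ) = 2 ^ 3 by norm_num,
        Real.log_pow]
      push_cast
      nlinarith
    have h2 : (p : ℝ) ^ 2 ≤ n ^ 2 := pow_le_pow_left₀ (by linarith) (by linarith) 2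
    linarith
  have hnz : n ≠ 0 := by
    rintro rfl
    norm_num at hn0
  have hmain := le_numThreshold_of_sum_le (n := n) (p := p) hnz (by linarith)
  have hT : (0 : ℝ) < numThreshold n := by
    have : (0 : ℝ) < 2 ^ (p * n) := by positivity
    exact pos_of_mul_pos_right (this.trans_le hmain) (by positivity)
  have hlogs := Real.log_le_log (by positivity) hmain
  rw [Real.log_pow, Real.log_mul (by positivity) hT.ne', Real.log_mul two_ne_zero (by positivity),
    Real.log_pow] at hlogs
  have hplog : p * Real.log p ≤ n * L := by
    apply mul_le_mul
    · linarith
    · exact Real.log_le_log (by linarith) (by linarith)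
    · exact Real.log_nonneg hp1
    · linarith
  rw [Real.logb, le_div_iff₀ (by linarith)]
  push_cast at hlogs
  have h1 : ((n : ℝ) - 8 * n / L - 1) * n * Real.log 2 ≤ p * n * Real.log 2 := by
    gcongr
    linarith
  have h2 : 10 * (n : ℝ) ^ 2 / L = 10 * (n * (n / L)) := by ring
  have h3 : n * L + (n + 1) * Real.log 2 ≤ 2 * (n * (n / L)) * Real.log 2 := by
    have hL0 : 0 < L := by linarith
    have h4 : L * (n / L) = n := by field_simp
    have h5 : L ^ 2 ≤ 6 * (n / L) := by
      rw [← mul_div_assoc, le_div_iff₀ hL0]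
      linarith
    have h6 : 6 * L ≤ L ^ 2 - 4 * L := by nlinarith
    have h7 : L + 0.7 * 2 ≤ 2 * (n / L) * 0.69 := by nlinarith
    calc n * L + (n + 1) * Real.log 2 ≤ n * L + (n + n) * 0.7 := by gcongr <;> linarith
      _ = n * (L + 0.7 * 2) := by ring
      _ ≤ n * (2 * (n / L) * 0.69) := by gcongr
      _ = 2 * (n * (n / L)) * 0.69 := by ring
      _ ≤ 2 * (n * (n / L)) * Real.log 2 := by gcongr; linarith
  rw [h2]
  rw [hdiv] at h1
  nlinarith

/-! ### Bounds for log R_n and the asymptotics -/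

theorem numThreshold_le_two_pow (n : ℕ) (hn : 2 ≤ n) : numThreshold n ≤ 2 ^ (n ^ 2) :=
  (numThreshold_le_sum_choose n).trans (sum_choose_two_pow_le n hn)

theorem numThreshold_pos (n : ℕ) : 0 < numThreshold n := by
  rw [numThreshold_eq_card]
  exact Finset.card_pos.2 ⟨Finset.univ, mem_thresholdSets_iff.2
    ⟨Pi.single 0 1, fun x => by simp [thresholdForm_single_zero]⟩⟩

theorem mul_numThreshold_lt_numResonance (n : ℕ) (hn : 2 ≤ n) :
    ((n : ℝ) + 1) / 2 ^ (n + 1) * numThreshold n < numResonance n := by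
  rw [div_mul_eq_mul_div, div_lt_iff₀ (by positivity), mul_comm (numResonance n : ℝ)]
  exact_mod_cast lt_numResonance n hn

theorem numResonance_lt_half (n : ℕ) (hn : 2 ≤ n) :
    (numResonance n : ℝ) < 1 / 2 * numThreshold n := by
  have : 2 * (numResonance n : ℝ) < numThreshold n := by
    exact_mod_cast two_mul_numResonance_lt n hn
  linarith

theorem numResonance_pos (n : ℕ) (hn : 2 ≤ n) : 0 < numResonance n := by
  have h := lt_numResonance n hn
  by_contra h0
  rw [Nat.eq_zero_of_not_pos h0, mul_zero] at h
  exact Nat.not_lt_zero _ h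

theorem logb_numResonance_lt (n : ℕ) (hn : 2 ≤ n) :
    Real.logb 2 (numResonance n) < (n : ℝ) ^ 2 - 1 := by
  have h0 : (0 : ℝ) < numResonance n := by exact_mod_cast numResonance_pos n hn
  rw [Real.logb_lt_iff_lt_rpow one_lt_two h0, Real.rpow_sub_one two_ne_zero]
  have h1 : (numThreshold n : ℝ) ≤ 2 ^ (n ^ 2) := by exact_mod_cast numThreshold_le_two_pow n hn
  have h2 : (2 : ℝ) ^ ((n : ℝ) ^ 2) = 2 ^ (n ^ 2) := by
    rw [← Nat.cast_pow, Real.rpow_natCast]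
  rw [h2]
  linarith [numResonance_lt_half n hn]

theorem lt_logb_numResonance (n : ℕ) (hn : 2 ≤ n) :
    (n : ℝ) ^ 2 - 10 * (n : ℝ) ^ 2 / Real.log n - n + Real.logb 2 ((n : ℝ) + 1) - 1 <
      Real.logb 2 (numResonance n) := by
  have hn2 : (2 : ℝ) ≤ n := by exact_mod_cast hn
  rcases le_or_gt 10 (Real.log n) with hL | hL
  · have hT : (0 : ℝ) < numThreshold n := by exact_mod_cast numThreshold_pos n
    have h1 := Real.logb_lt_logb one_lt_two (by positivity)
      (mul_numThreshold_lt_numResonance n hn)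
    rw [Real.logb_mul (by positivity) hT.ne', Real.logb_div (by positivity) (by positivity),
      Real.logb_pow, Real.logb_self_eq_one one_lt_two] at h1
    push_cast at h1
    linarith [le_logb_numThreshold hL]
  -- For ln n < 10 the left side is negative: 10n²/ln n ≥ n² and log₂(n+1) ≤ n, while R_n ≥ 1.
  · have hL0 : 0 < Real.log n := Real.log_pos (by linarith)
    have h1 : (n : ℝ) ^ 2 ≤ 10 * (n : ℝ) ^ 2 / Real.log n := by
      rw [le_div_iff₀ hL0]
      nlinarith [sq_nonneg (n : ℝ)]
    have h2 : Real.logb 2 ((n : ℝ) + 1) ≤ n := by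
      rw [Real.logb_le_iff_le_rpow one_lt_two (by positivity), Real.rpow_natCast]
      exact_mod_cast Nat.lt_two_pow_self (n := n)
    have h3 : 0 ≤ Real.logb 2 (numResonance n) :=
      Real.logb_nonneg one_lt_two (by exact_mod_cast numResonance_pos n hn)
    linarith

theorem logb_numResonance_isEquivalent :
    (fun n : ℕ => Real.logb 2 (numResonance n : ℝ)) ~[atTop] (fun n : ℕ => (n : ℝ) ^ 2) := by
  have hne : ∀ᶠ n : ℕ in atTop, (n : ℝ) ^ 2 ≠ 0 := by
    filter_upwards [eventually_ge_atTop 1] with n hn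
    positivity
  rw [isEquivalent_iff_tendsto_one hne]
  have hcast := tendsto_natCast_atTop_atTop (R := ℝ)
  have hlow : Tendsto (fun n : ℕ => 1 - 10 / Real.log n - 1 / (n : ℝ)) atTop (nhds 1) := by
    have h1 : Tendsto (fun n : ℕ => 10 / Real.log n) atTop (nhds 0) :=
      tendsto_const_nhds.div_atTop (Real.tendsto_log_atTop.comp hcast)
    have h2 : Tendsto (fun n : ℕ => 1 / (n : ℝ)) atTop (nhds 0) :=
      tendsto_const_nhds.div_atTop hcast
    simpa using (tendsto_const_nhds.sub h1).sub h2
  refine tendsto_of_tendsto_of_tendsto_of_le_of_le' hlow tendsto_const_nhds ?_ ?_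
  · filter_upwards [eventually_ge_atTop 2] with n hn
    have hn2 : (2 : ℝ) ≤ n := by exact_mod_cast hn
    have h1 : 1 ≤ Real.logb 2 ((n : ℝ) + 1) := by
      rw [Real.le_logb_iff_rpow_le one_lt_two (by positivity), Real.rpow_one]
      linarith
    have h2 := lt_logb_numResonance n hn
    rw [Pi.div_apply, le_div_iff₀ (by positivity)]
    have h3 : (1 - 10 / Real.log n - 1 / (n : ℝ)) * (n : ℝ) ^ 2 =
        (n : ℝ) ^ 2 - 10 * (n : ℝ) ^ 2 / Real.log n - n := by
      field_simp
    linarith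
  · filter_upwards [eventually_ge_atTop 2] with n hn
    have hn2 : (2 : ℝ) ≤ n := by exact_mod_cast hn
    rw [Pi.div_apply, div_le_one (by positivity)]
    linarith [logb_numResonance_lt n hn]

theorem mainTheorem1 :
    (∀ n : ℕ, numThreshold n =
      Nat.card {f : (Fin n → ℤˣ) → ℤˣ // IsThresholdFunction f}) ∧
    (∀ n : ℕ, 2 ≤ n →
      ((n : ℝ) + 1) / 2 ^ (n + 1) * (numThreshold n : ℝ) < (numResonance n : ℝ) ∧
      (numResonance n : ℝ) < 1 / 2 * (numThreshold n : ℝ)) ∧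
    (∀ n : ℕ, 2 ≤ n →
      (n : ℝ) ^ 2 - 10 * (n : ℝ) ^ 2 / Real.log (n : ℝ) - (n : ℝ)
          + Real.logb 2 ((n : ℝ) + 1) - 1
        < Real.logb 2 (numResonance n : ℝ) ∧
      Real.logb 2 (numResonance n : ℝ) < (n : ℝ) ^ 2 - 1) ∧
    (fun n : ℕ => Real.logb 2 (numResonance n : ℝ)) ~[atTop] (fun n : ℕ => (n : ℝ) ^ 2) :=
  ⟨numThreshold_eq_card_thresholdFunction,
    fun n hn => ⟨mul_numThreshold_lt_numResonance n hn, numResonance_lt_half n hn⟩,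
    fun n hn => ⟨lt_logb_numResonance n hn, logb_numResonance_lt n hn⟩,
    logb_numResonance_isEquivalent⟩
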